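/- Let $d\ge 3$, $m\ge 0$, and let $G$ be a compact subgroup of the unitary group $U(m)$ (for example $SU(m)$, $SO(m)$, $U(m)$), with normalized Haar measure $\mu_G$; thus $\mathrm{Tr}\,\mathrm{Id}_G=m$. For a finite set $\Lambda\subset\mathbb Z^d$, let $\vec E(\Lambda)$ be the set of ordered pairs of nearest neighbours in $\Lambda$. For $\beta>0$, the Nishimori disorder is a random family $\omega=(\Omega_{i,j})_{(i,j)\in\vec E(\Lambda)}$ of elements of $G$ with $\Omega_{j,i}=\Omega_{i,j}^*$, independent over distinct unoriented edges, each $\Omega_{i,j}$ having the law $$d\rho_\beta(\Omega)=Z_{\rho_\beta}^{-1}e^{\beta\,\mathrm{Re}\,\mathrm{Tr}\,\Omega}\,d\mu_G(\Omega),\qquad Z_{\rho_\beta}=\int_G e^{\beta\,\mathrm{Re}\,\mathrm{Tr}\,\Omega}\,d\mu_G(\Omega).$$ Expectation over $\omega$ is denoted by $\mathbb E_\beta^G$. Given $\omega$, let $\langle\cdot\rangle_{\omega,\beta,\Lambda}$ be expectation under the probability measure on spin configurations $U=(U(i))_{i\in\Lambda}\in G^\Lambda$ proportional to $$\exp\Big(\tfrac{\beta}{2}\sum_{(i,j)\in\vec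 E(\Lambda)}\mathrm{Re}\,\mathrm{Tr}\big(U^*(i)\,\Omega_{i,j}\,U(j)\big)\Big)\prod_{i\in\Lambda}d\mu_G(U(i))$$ (free boundary conditions). For $\partial\Lambda\subset\Lambda$, let $\langle\cdot\rangle^0_{\omega,\beta,\Lambda}$ be defined in the same way, with $d\mu_G(U(i))$ replaced by the Dirac mass at $\mathrm{Id}_G$ for every $i\in\partial\Lambda$ (Dirichlet boundary conditions); the law of the disorder is unchanged. There exist constants $\beta^*>0$ and $a>0$, depending only on $d$ and $G$, such that for every $\beta\ge\beta^*$ the following hold. 1. For every finite $\Lambda\subset\mathbb Z^d$ and all $x,y\in\Lambda$ such that every lattice point of the open Euclidean ball $B\big(\tfrac{x+y}{2},2\|x-y\|_2\big)$ belongs to $\Lambda$, $$\mathbb E_\beta^G\Big[\big\langle \mathrm{Re}\,\mathrm{Tr}\,U^*(x)U(y)\big\rangle_{\omega,\beta,\Lambda}\Big]\ \ge\ \Big(1-\sqrt{\tfrac{a\log\beta}{\beta}}\Big)\,\mathrm{Tr}\,\mathrm{Id}_G .$$ 2. (Spontaneous magnetization.) Let $\Lambda_n=\{-n,\dots,n\}^d$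 and let $\partial\Lambda_n\subset\Lambda_n$, $n\ge 0$, be any sets such that $\partial\Lambda_n$ contains every point of $\Lambda_n$ with a nearest neighbour outside $\Lambda_n$. Then, with Dirichlet boundary conditions on $\partial\Lambda_n$, $$\liminf_{n\to\infty}\ \mathbb E_\beta^G\Big[\big\langle \mathrm{Re}\,\mathrm{Tr}\,U(0)\big\rangle^0_{\omega,\beta,\Lambda_n}\Big]\ \ge\ \Big(1-\sqrt{\tfrac{a\log\beta}{\beta}}\Big)\,\mathrm{Tr}\,\mathrm{Id}_G .$$ -/

import Mathlib

open MeasureTheory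

noncomputable section

namespace NishimoriSpin

/-- The nearest-neighbour graph on `ℤ^d`: two points are adjacent when their `ℓ¹` distance is 1. -/
def latticeGraph (d : ℕ) : SimpleGraph (Fin d → ℤ) where
  Adj x y := ∑ k, |x k - y k| = 1
  symm := ⟨fun x y h => by simpa only [abs_sub_comm] using h⟩
  loopless := ⟨fun x h => by simp at h⟩

/-- A lattice point seen as a point of Euclidean space. -/
def toEuclid {d : ℕ} (x : Fin d → ℤ) : EuclideanSpace ℝ (Fin d) :=
  WithLp.toLp 2 (fun k => (x k : ℝ))

/-- The box `{-n, …, n}^d`. -/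
def box (d n : ℕ) : Finset (Fin d → ℤ) :=
  Finset.Icc (fun _ => -(n : ℤ)) (fun _ => (n : ℤ))

theorem zero_mem_box (d n : ℕ) : (0 : Fin d → ℤ) ∈ box d n := by
  rw [box, Finset.mem_Icc]
  exact ⟨fun k => by simp, fun k => by simp⟩

open Classical in
/-- The interior boundary of `Λ`: the points of `Λ` that have a neighbour outside `Λ`. -/
def innerBoundary {d : ℕ} (Λ : Finset (Fin d → ℤ)) : Finset (Fin d → ℤ) :=
  {x ∈ Λ | ∃ y, (latticeGraph d).Adj x y ∧ y ∉ Λ}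

/-- `Re Tr g` for an element `g` of a subgroup of the unitary group `U(m)`. -/
def reTr {m : ℕ} {G : Subgroup (Matrix.unitaryGroup (Fin m) ℂ)} (g : G) : ℝ :=
  (Matrix.trace ((g : Matrix.unitaryGroup (Fin m) ℂ) : Matrix (Fin m) (Fin m) ℂ)).re

instance {m : ℕ} : MeasurableSpace (Matrix.unitaryGroup (Fin m) ℂ) := borel _

instance {m : ℕ} : BorelSpace (Matrix.unitaryGroup (Fin m) ℂ) := ⟨rfl⟩

section Model

variable {m : ℕ} (G : Subgroup (Matrix.unitaryGroup (Fin m) ℂ)) [CompactSpace G]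

/-- The Haar measure of the compact group `G`, normalized to total mass 1. -/
def haarProb : Measure G := Measure.haarMeasure ⊤

/-- The law `Z⁻¹ exp (u Re Tr g) dμ_G(g)` of the disorder on one edge. -/
def edgeLaw (u : ℝ) : Measure G := (haarProb G).tilted (fun g => u * reTr g)

variable {d : ℕ} (Λ : Finset (Fin d → ℤ))

/-- The edges of `Λ` in the reference orientation, from `x` to `x + e_k`: for adjacent points
this is the coordinatewise order. Each unoriented edge occurs exactly once. -/
abbrev PosEdge : Type :=
  {e : Λ × Λ // (latticeGraph d).Adj e.1 e.2 ∧ (e.1 : Fin d → ℤ) < e.2}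

instance : Finite (PosEdge Λ) := Subtype.finite

instance : Fintype (PosEdge Λ) := Fintype.ofFinite _

/-- The law of the disorder: independent `G`-valued matrices with law `edgeLaw G u`, one for each
unoriented edge. -/
def disorderLaw (u : ℝ) : Measure (PosEdge Λ → G) := Measure.pi (fun _ => edgeLaw G u)

variable {G Λ}

open Classical in
/-- The disorder on oriented edges: the sampled matrix along the reference orientation, its
adjoint (that is, its inverse in the unitary group) along the opposite one. The value 1 on pairs
that are not edges is never used. -/
def orientedDisorder (ω : PosEdge Λ → G) (i j : Λ) : G :=
  if h : (latticeGraph d).Adj i j ∧ (i : Fin d → ℤ) < j then ω ⟨(i, j), h⟩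
  else if h : (latticeGraph d).Adj j i ∧ (j : Fin d → ℤ) < i then (ω ⟨(j, i), h⟩)⁻¹
  else 1

open Classical in
/-- `½ ∑ Re Tr (U(i)^* Ω_{ij} U(j))`, the sum over all oriented edges `(i, j)` of `Λ`.
The adjoint `U(i)^*` is the inverse in the unitary group. -/
def interaction (ω : PosEdge Λ → G) (U : Λ → G) : ℝ :=
  (1 / 2) * ∑ e : Λ × Λ with (latticeGraph d).Adj e.1 e.2,
    reTr ((U e.1)⁻¹ * orientedDisorder ω e.1 e.2 * U e.2)

variable (G Λ)

open Classical in
/-- The reference measure on spin configurations: Haar measure at each site outside `bd`, the unit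
mass at the identity at each site of `bd`. Free boundary conditions are `bd = ∅`. -/
def spinMeasure (bd : Finset (Fin d → ℤ)) : Measure (Λ → G) :=
  Measure.pi (fun i : Λ => if (i : Fin d → ℤ) ∈ bd then Measure.dirac 1 else haarProb G)

variable {G Λ}

/-- The quenched Gibbs measure at inverse temperature `β` in the disorder `ω`, the normalization
of `exp (β * interaction ω U)` times the reference measure. -/
def gibbs (β : ℝ) (bd : Finset (Fin d → ℤ)) (ω : PosEdge Λ → G) : Measure (Λ → G) :=
  (spinMeasure G Λ bd).tilted (fun U => β * interaction ω U)

variable (G Λ)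

/-- The averaged quenched expectation of the observable `f` on the Nishimori line, where the
disorder parameter `u` equals `β`. -/
def nishimoriExpectation (β : ℝ) (bd : Finset (Fin d → ℤ)) (f : (Λ → G) → ℝ) : ℝ :=
  ∫ ω, (∫ U, f U ∂(gibbs β bd ω)) ∂(disorderLaw G Λ β)

end Model

end NishimoriSpin

end

open MeasureTheory

noncomputable section

namespace NishimoriSpin

/-! ### Generating functions of coincidence counts -/

section Unpredictable

open Finset

/-! On the Nishimori line the density of the disorder is the Gibbs weight of the trivial
configuration (`disorderLaw_eq_tilted`). Gauge invariance then yields `nishimori_identity`: a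
gauge-invariant observable of spins and disorder may be averaged with all spins set to 1. Alignment
thus becomes an inference problem: two spins are aligned as well as some gauge-equivariant function
of the disorder estimates their relative gauge (`misalignment_le_of_estimator`).

The estimator averages, over a family of paths from x to y, the ordered product of the matrices `B *
Ω` along the path, where `B` inverts the mean of `Ω`. This mean commutes with `G`, so the products
are equivariant. Edges are independent, so the product along a path that repeats no edge has mean 1,
and two such products have a correlation of norm at most `c ^ (2 * N)`, where `c ≥ ‖B‖` and `N`
bounds the number of shared edges (`norm_integral_wordProd_mul_le`). The variance is therefore
small, uniformly in the distance, once the exponential moment of the number of shared edges is close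
to 1.

In dimension at least 3 there are such paths: they advance along one axis while a random
displacement, built from independent pieces on all scales, spreads over two transverse directions.
Given earlier positions, a prescribed position `k` time units later has probability `O(k ^ (-4/3))`,
which is summable; a renewal argument bounds the generating function (`exists_unpredictable_paths`).

Low temperature enters through `exists_integral_edgeLaw_le`: the mean edge energy is `O(log β / β)`,
so the mean of `Ω` is within `η = O(√(log β / β))` of 1, and the alignment error along an axis is
`O(η)`, for every boundary set. For free boundary conditions, x is joined to y one coordinate at a
time inside the ball; for Dirichlet conditions, the origin is joined along an axis to a boundary
spin, which equals 1. -/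

theorem sum_powerset_range {M : Type*} [AddCommMonoid M] (g : Finset ℕ → M) (n : ℕ) :
    ∑ A ∈ (range n).powerset, g A =
      g ∅ + ∑ t ∈ range n, ∑ A ∈ (range t).powerset, g (insert t A) := by
  induction n with
  | zero => simp
  | succ n ih =>
    rw [Finset.range_add_one, Finset.sum_powerset_insert Finset.notMem_range_self, ih,
      Finset.sum_insert Finset.notMem_range_self]
    abel

/-- A renewal-type bound: if each new element `u` of a set of times costs a factor `p (u - t)`,
where `t` is the preceding time, then the generating function over all sets is controlled by
`∑ p`. -/
theorem sum_powerset_renewal (L : ℕ) (c : Finset ℕ → ℝ) (p : ℕ → ℝ) (s M : ℝ)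
    (hc : ∀ A, 0 ≤ c A) (hp : ∀ k, 0 ≤ p k) (hs : 0 ≤ s) (hsM : s * M ≤ 1 / 2)
    (hM : ∑ k ∈ range L, p k ≤ M)
    (h0 : ∀ u < L, c {u} ≤ c ∅ * p u)
    (h1 : ∀ u < L, ∀ t < u, ∀ A ⊆ range t,
      c (insert u (insert t A)) ≤ c (insert t A) * p (u - t)) :
    ∑ A ∈ (range L).powerset, s ^ #A * c A ≤ c ∅ * (1 + 2 * (s * M)) := by
  -- `F u` is the weight of the sets with largest element `u`. Splitting them by their second
  -- largest element gives the renewal inequality `hrec`.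
  set F : ℕ → ℝ := fun u => ∑ A ∈ (range u).powerset, s ^ (#A + 1) * c (insert u A) with hF
  have hFnn : ∀ u, 0 ≤ F u := fun u => sum_nonneg fun A _ => mul_nonneg (pow_nonneg hs _) (hc _)
  have hcard : ∀ t, ∀ A ∈ (range t).powerset, #(insert t A) = #A + 1 := by
    intro t A hA
    refine Finset.card_insert_of_notMem fun h => ?_
    simpa using mem_powerset.1 hA h
  have hrec : ∀ u < L, F u ≤ s * (c ∅ * p u + ∑ t ∈ range u, F t * p (u - t)) := by
    intro u hu
    rw [hF]
    simp only
    rw [sum_powerset_range, mul_add, mul_sum]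
    refine add_le_add ?_ (sum_le_sum fun t ht => ?_)
    · simpa using mul_le_mul_of_nonneg_left (h0 u hu) hs
    · rw [sum_mul, mul_sum]
      refine sum_le_sum fun A hA => ?_
      rw [hcard t A hA]
      have := h1 u hu t (mem_range.1 ht) A (mem_powerset.1 hA)
      calc s ^ (#A + 1 + 1) * c (insert u (insert t A))
          ≤ s ^ (#A + 1 + 1) * (c (insert t A) * p (u - t)) :=
            mul_le_mul_of_nonneg_left this (pow_nonneg hs _)
        _ = s * (s ^ (#A + 1) * c (insert t A) * p (u - t)) := by ring
  have hM0 : 0 ≤ M := (sum_nonneg fun k _ => hp k).trans hM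
  have hconv : ∑ u ∈ range L, ∑ t ∈ range u, F t * p (u - t) ≤ M * ∑ t ∈ range L, F t := by
    have : ∑ u ∈ range L, ∑ t ∈ range u, F t * p (u - t) =
        ∑ t ∈ range L, ∑ u ∈ Ico (t + 1) L, F t * p (u - t) := by
      refine Finset.sum_comm' fun u t => ?_
      simp only [mem_range, mem_Ico]
      omega
    rw [this, mul_sum]
    refine sum_le_sum fun t _ => ?_
    rw [← mul_sum, mul_comm]
    refine mul_le_mul_of_nonneg_right (le_trans ?_ hM) (hFnn t)
    rw [Finset.sum_Ico_eq_sum_range]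
    calc ∑ i ∈ range (L - (t + 1)), p (t + 1 + i - t)
        = ∑ i ∈ range (L - (t + 1)), p (i + 1) :=
          sum_congr rfl fun i _ => by congr 1; omega
      _ ≤ ∑ i ∈ range L, p i := by
          rcases Nat.eq_zero_or_pos L with rfl | hL
          · simp
          · obtain ⟨L', rfl⟩ : ∃ L', L = L' + 1 := ⟨L - 1, by omega⟩
            rw [Finset.sum_range_succ' p L']
            refine le_add_of_le_of_nonneg ?_ (hp 0)
            refine sum_le_sum_of_subset_of_nonneg ?_ fun i _ _ => hp _
            exact Finset.range_subset_range.2 (by omega)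
  have hS : ∑ u ∈ range L, F u ≤ s * M * c ∅ + s * M * ∑ u ∈ range L, F u := by
    calc ∑ u ∈ range L, F u
        ≤ ∑ u ∈ range L, s * (c ∅ * p u + ∑ t ∈ range u, F t * p (u - t)) :=
          sum_le_sum fun u hu => hrec u (mem_range.1 hu)
      _ = s * (c ∅ * ∑ u ∈ range L, p u + ∑ u ∈ range L, ∑ t ∈ range u, F t * p (u - t)) := by
          rw [← mul_sum, sum_add_distrib, mul_sum (range L) p]
      _ ≤ s * (c ∅ * M + M * ∑ t ∈ range L, F t) :=
          mul_le_mul_of_nonneg_left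
            (add_le_add (mul_le_mul_of_nonneg_left hM (hc _)) hconv) hs
      _ = _ := by ring
  have hSnn : 0 ≤ ∑ u ∈ range L, F u := sum_nonneg fun u _ => hFnn u
  -- The sum on the right of `hS` is absorbed because `s * M ≤ 1 / 2`.
  have hS2 : ∑ u ∈ range L, F u ≤ 2 * (s * M) * c ∅ := by nlinarith
  rw [sum_powerset_range]
  have : ∑ t ∈ range L, ∑ A ∈ (range t).powerset, s ^ #(insert t A) * c (insert t A) =
      ∑ u ∈ range L, F u :=
    sum_congr rfl fun t _ => sum_congr rfl fun A hA => by rw [hcard t A hA]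
  rw [this]
  simp only [card_empty, pow_zero, one_mul]
  linarith

open Classical in
/-- If over every time gap the position of a random path is spread by an independent coordinate,
its number of coincidences with a fixed path has a generating function close to 1. -/
theorem sum_pow_card_coincidences_le {ι β : Type*} [Fintype ι] {V : ι → Type*}
    [∀ i, Fintype (V i)] (f : (∀ i, V i) → ℕ → β) (g : ℕ → β) (L : ℕ) (p : ℕ → ℝ) (s M : ℝ)
    (hp : ∀ k, 0 ≤ p k) (hs : 0 ≤ s) (hsM : s * M ≤ 1 / 2) (hM : ∑ k ∈ range L, p k ≤ M)
    (H : ∀ u < L, ∀ t ≤ u, ∃ i, 1 ≤ Fintype.card (V i) * p (u - t) ∧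
      (∀ D v, ∀ r ≤ t, f (Function.update D i v) r = f D r) ∧
      ∀ D, Function.Injective fun v => f (Function.update D i v) u) :
    ∑ D, (1 + s) ^ #{u ∈ range L | f D u = g u} ≤
      Fintype.card (∀ i, V i) * (1 + 2 * (s * M)) := by
  set c : Finset ℕ → ℝ := fun A => (#{D : ∀ i, V i | ∀ r ∈ A, f D r = g r} : ℝ) with hcdef
  have key : ∀ u < L, ∀ t ≤ u, ∀ A ⊆ range (t + 1), c (insert u A) ≤ c A * p (u - t) := by
    intro u hu t htu A hA
    obtain ⟨i, hi1, hi2, hi3⟩ := H u hu t htu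
    -- Resampling coordinate `i` keeps the coincidences up to time `t`. The map `(D, v) ↦ update D i
    -- v` is injective here: the lost value `D i` is recovered from the prescribed position `g u`.
    have hcnt : c (insert u A) * Fintype.card (V i) ≤ c A := by
      rw [hcdef]
      simp only
      rw [← Finset.card_univ, ← Nat.cast_mul, ← Finset.card_product]
      refine Nat.cast_le.2 (Finset.card_le_card_of_injOn
        (fun x => Function.update x.1 i x.2) ?_ ?_)
      · intro x hx
        simp only [coe_product, Set.mem_prod, mem_coe, mem_filter, mem_univ, true_and,
          and_true] at hx ⊢
        intro r hr
        rw [hi2 x.1 x.2 r (Nat.lt_succ_iff.1 (mem_range.1 (hA hr)))]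
        exact hx r (mem_insert_of_mem hr)
      · rintro ⟨D, v⟩ hx ⟨D', v'⟩ hx' heq
        simp only [coe_product, Set.mem_prod, mem_coe, mem_filter, mem_univ, true_and,
          and_true] at hx hx' heq
        have hv : v = v' := by simpa using congrFun heq i
        have hD : Function.update D' i (D i) = D := by
          funext j
          by_cases hj : j = i
          · subst hj; simp
          · have := congrFun heq j
            rw [Function.update_of_ne hj] at this ⊢
            rw [Function.update_of_ne hj] at this
            exact this.symm
        have h1 := hx u (mem_insert_self _ _)
        have h2 := hx' u (mem_insert_self _ _)
        have h3 := @hi3 D' (D i) (D' i) (by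
          simp only [hD, Function.update_eq_self, h1, h2])
        rw [h3, Function.update_eq_self] at hD
        rw [hD, hv]
    have hcn : 0 ≤ c (insert u A) := Nat.cast_nonneg _
    calc c (insert u A) ≤ c (insert u A) * (Fintype.card (V i) * p (u - t)) :=
          le_mul_of_one_le_right hcn hi1
      _ = (c (insert u A) * Fintype.card (V i)) * p (u - t) := by ring
      _ ≤ c A * p (u - t) := mul_le_mul_of_nonneg_right hcnt (hp _)
  have hc0 : c ∅ = Fintype.card (∀ i, V i) := by
    simp [hcdef, Finset.card_univ]
  have main := sum_powerset_renewal L c p s M (fun A => Nat.cast_nonneg _) hp hs hsM hM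
    (fun u hu => by simpa using key u hu 0 (Nat.zero_le _) ∅ (by simp))
    (fun u hu t ht A hA => key u hu t ht.le _ (by
      rw [Finset.range_add_one]
      exact insert_subset_insert _ hA))
  rw [hc0] at main
  refine le_trans (le_of_eq ?_) main
  -- The binomial expansion turns the power into a sum over sets of coincidence times.
  have e1 : ∀ D : (∀ i, V i), (1 + s) ^ #{u ∈ range L | f D u = g u} =
      ∑ A ∈ (range L).powerset, if ∀ r ∈ A, f D r = g r then s ^ #A else 0 := by
    intro D
    rw [← Finset.sum_filter]
    have := Finset.sum_pow_mul_eq_add_pow s 1 ({u ∈ range L | f D u = g u})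
    rw [add_comm, ← this]
    simp only [one_pow, mul_one]
    refine Finset.sum_congr ?_ fun _ _ => rfl
    ext A
    simp only [mem_powerset, mem_filter, subset_iff, mem_range]
    constructor
    · intro h; exact ⟨fun x hx => (h hx).1, fun x hx => (h hx).2⟩
    · intro h x hx; exact ⟨h.1 hx, h.2 x hx⟩
  rw [Finset.sum_congr rfl fun D _ => e1 D, Finset.sum_comm]
  refine Finset.sum_congr rfl fun A _ => ?_
  rw [← Finset.sum_filter, Finset.sum_const, nsmul_eq_mul, hcdef]
  ring

end Unpredictable

/-! ### A multiscale random path in the plane -/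

section RandomPath

open Finset

/-- The 2-adic valuation of a time: the scale that moves at this time. -/
def scaleAt (v : ℕ) : ℕ := padicValNat 2 v

/-- The index of the block, among those of scale `scaleAt v`, to which the time `v` belongs. -/
def blockAt (v : ℕ) : ℕ := v / 2 ^ (scaleAt v + 1) / (2 * 4 ^ scaleAt v)

/-- The rank of the time `v` among the times of its block. -/
def rankAt (v : ℕ) : ℕ := v / 2 ^ (scaleAt v + 1) % (2 * 4 ^ scaleAt v)

/-- The time of rank `r` in block `b` of scale `i`. -/
def timeOf (i b r : ℕ) : ℕ := 2 ^ i * (2 * (b * (2 * 4 ^ i) + r) + 1)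

theorem timeOf_injective (i b : ℕ) : Function.Injective (timeOf i b) := by
  intro r r' h
  have := Nat.eq_of_mul_eq_mul_left (by positivity) h
  omega

theorem scaleAt_timeOf (i b r : ℕ) : scaleAt (timeOf i b r) = i := by
  unfold scaleAt timeOf
  rw [padicValNat.mul (by positivity) (by positivity), padicValNat.prime_pow,
    padicValNat.eq_zero_of_not_dvd (by omega), add_zero]

theorem timeOf_div (i b r : ℕ) : timeOf i b r / 2 ^ (i + 1) = b * (2 * 4 ^ i) + r := by
  unfold timeOf
  rw [pow_succ, Nat.mul_div_mul_left _ _ (by positivity)]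
  omega

theorem blockAt_timeOf {i b r : ℕ} (hr : r < 2 * 4 ^ i) : blockAt (timeOf i b r) = b := by
  unfold blockAt
  rw [scaleAt_timeOf, timeOf_div, mul_comm b, Nat.mul_add_div (by positivity),
    Nat.div_eq_of_lt hr, add_zero]

theorem rankAt_timeOf {i b r : ℕ} (hr : r < 2 * 4 ^ i) : rankAt (timeOf i b r) = r := by
  unfold rankAt
  rw [scaleAt_timeOf, timeOf_div, mul_comm b, Nat.mul_add_mod, Nat.mod_eq_of_lt hr]

theorem timeOf_scaleAt {v : ℕ} (hv : v ≠ 0) : timeOf (scaleAt v) (blockAt v) (rankAt v) = v := by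
  have hdvd : 2 ^ scaleAt v ∣ v := pow_padicValNat_dvd
  obtain ⟨w, hw⟩ := hdvd
  have hodd : ¬ 2 ∣ w := by
    rintro ⟨z, rfl⟩
    refine pow_succ_padicValNat_not_dvd (p := 2) hv ⟨z, ?_⟩
    change v = 2 ^ (scaleAt v + 1) * z
    rw [pow_succ, mul_assoc]; exact hw
  have hdiv : v / 2 ^ (scaleAt v + 1) = w / 2 := by
    calc v / 2 ^ (scaleAt v + 1) = 2 ^ scaleAt v * w / (2 ^ scaleAt v * 2) := by
          rw [← hw, pow_succ]
      _ = w / 2 := Nat.mul_div_mul_left _ _ (by positivity)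
  unfold timeOf blockAt rankAt
  rw [mul_comm _ (2 * 4 ^ scaleAt v), Nat.div_add_mod, hdiv]
  conv_rhs => rw [hw]
  congr 1
  omega

/-- Times of scale `i` are spaced by `2 ^ (i + 1)` and a block has `2 * 4 ^ i` of them. With
`le_timeOf`, block `b` is confined to a window of length `4 * 8 ^ i`. -/
theorem timeOf_lt {i b r : ℕ} (hr : r < 2 * 4 ^ i) : timeOf i b r < 4 * 8 ^ i * (b + 1) := by
  unfold timeOf
  have h8 : (8 : ℕ) ^ i = 2 ^ i * 4 ^ i := by rw [← mul_pow]; norm_num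
  calc 2 ^ i * (2 * (b * (2 * 4 ^ i) + r) + 1) < 2 ^ i * (4 * 4 ^ i * (b + 1)) := by
        refine Nat.mul_lt_mul_of_pos_left ?_ (by positivity)
        nlinarith
    _ = _ := by rw [h8]; ring

theorem le_timeOf (i b r : ℕ) : 4 * 8 ^ i * b ≤ timeOf i b r := by
  unfold timeOf
  have h8 : (8 : ℕ) ^ i = 2 ^ i * 4 ^ i := by rw [← mul_pow]; norm_num
  calc 4 * 8 ^ i * b = 2 ^ i * (4 * 4 ^ i * b) := by rw [h8]; ring
    _ ≤ _ := Nat.mul_le_mul_left _ (by nlinarith)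

/-- The random displacements: a pair of integers in `[0, 4 ^ i)` for each block of scale `i`. -/
abbrev Displacements (L : ℕ) : Type :=
  (l : Fin L × Fin L) → Fin (4 ^ (l.1 : ℕ)) × Fin (4 ^ (l.1 : ℕ))

instance (L : ℕ) : Nonempty (Displacements L) :=
  ⟨fun _ => (⟨0, by positivity⟩, ⟨0, by positivity⟩)⟩

/-- The displacement of a block, zero when the label is out of range. -/
def displacement {L : ℕ} (D : Displacements L) (i b : ℕ) : ℕ × ℕ :=
  if h : i < L ∧ b < L then
    ((D (⟨i, h.1⟩, ⟨b, h.2⟩)).1, (D (⟨i, h.1⟩, ⟨b, h.2⟩)).2)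
  else 0

theorem displacement_fst_lt {L : ℕ} (D : Displacements L) (i b : ℕ) :
    (displacement D i b).1 < 4 ^ i := by
  unfold displacement
  split_ifs with h
  · exact (D (⟨i, h.1⟩, ⟨b, h.2⟩)).1.2
  · simp

/-- The move made at the time of rank `r` of a block with displacement `w`. -/
def moveAt (w : ℕ × ℕ) (M r : ℕ) : ℕ × ℕ :=
  (if r < w.1 then 1 else 0, if M ≤ r ∧ r < M + w.2 then 1 else 0)

/-- The first half of a block serves the first coordinate, the second half the other, so a completed
block realizes its displacement by unit moves. -/
theorem sum_moveAt {w : ℕ × ℕ} {M : ℕ} (h1 : w.1 ≤ M) (h2 : w.2 ≤ M) :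
    ∑ r ∈ range (2 * M), moveAt w M r = w := by
  have e1 : ({r ∈ range (2 * M) | r < w.1} : Finset ℕ) = range w.1 := by
    ext r; simp only [mem_filter, mem_range]; omega
  have e2 : ({r ∈ range (2 * M) | M ≤ r ∧ r < M + w.2} : Finset ℕ) = Ico M (M + w.2) := by
    ext r; simp only [mem_filter, mem_range, mem_Ico]; omega
  ext
  · simp [Prod.fst_sum, moveAt, e1]
  · simp [Prod.snd_sum, moveAt, e2]

/-- The step of the process at time `v`. -/
def stepAt {L : ℕ} (D : Displacements L) (v : ℕ) : ℕ × ℕ :=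
  moveAt (displacement D (scaleAt v) (blockAt v)) (4 ^ scaleAt v) (rankAt v)

/-- The position of the process at time `u`. -/
def position {L : ℕ} (D : Displacements L) (u : ℕ) : ℕ × ℕ := ∑ v ∈ range u, stepAt D v

theorem stepAt_cases {L : ℕ} (D : Displacements L) (v : ℕ) :
    stepAt D v = 0 ∨ stepAt D v = (1, 0) ∨ stepAt D v = (0, 1) := by
  have h1 := displacement_fst_lt D (scaleAt v) (blockAt v)
  unfold stepAt moveAt
  split_ifs with h h' h'
  · omega
  · simp
  · simp
  · left; rfl

theorem displacement_update_of_ne {L : ℕ} (D : Displacements L) (l : Fin L × Fin L)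
    (w : Fin (4 ^ (l.1 : ℕ)) × Fin (4 ^ (l.1 : ℕ))) {i b : ℕ} (h : ¬ (i = l.1 ∧ b = l.2)) :
    displacement (Function.update D l w) i b = displacement D i b := by
  unfold displacement
  split_ifs with h'
  · rw [Function.update_of_ne]
    rintro rfl
    exact h ⟨rfl, rfl⟩
  · rfl

theorem displacement_update_self {L : ℕ} (D : Displacements L) (l : Fin L × Fin L)
    (w : Fin (4 ^ (l.1 : ℕ)) × Fin (4 ^ (l.1 : ℕ))) :
    displacement (Function.update D l w) l.1 l.2 = ((w.1 : ℕ), (w.2 : ℕ)) := by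
  unfold displacement
  rw [dif_pos ⟨l.1.2, l.2.2⟩]
  simp

/-- Before its window opens, a block has made no move. -/
theorem position_update_of_le {L : ℕ} (D : Displacements L) (l : Fin L × Fin L)
    (hl : 1 ≤ (l.1 : ℕ)) (w : Fin (4 ^ (l.1 : ℕ)) × Fin (4 ^ (l.1 : ℕ))) {r : ℕ}
    (hr : r ≤ 4 * 8 ^ (l.1 : ℕ) * l.2) :
    position (Function.update D l w) r = position D r := by
  unfold position
  refine sum_congr rfl fun v hv => ?_
  unfold stepAt
  rw [displacement_update_of_ne]
  rintro ⟨h1, h2⟩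
  -- The valuation of 0 defaults to 0, so time 0 has scale 0; this is why positive scales are
  -- required.
  have hv0 : v ≠ 0 := by
    rintro rfl
    simp [scaleAt] at h1
    omega
  have := le_timeOf (scaleAt v) (blockAt v) (rankAt v)
  rw [timeOf_scaleAt hv0, h1, h2] at this
  have := mem_range.1 hv
  omega

/-- Once its window has closed, a block contributes exactly its displacement, and the other steps do
not depend on it. -/
theorem position_update_injective {L : ℕ} (D : Displacements L) (l : Fin L × Fin L)
    (hl : 1 ≤ (l.1 : ℕ)) {u : ℕ} (hu : 4 * 8 ^ (l.1 : ℕ) * (l.2 + 1) ≤ u) :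
    Function.Injective fun w => position (Function.update D l w) u := by
  have key : ∀ w, position (Function.update D l w) u =
      ((w.1 : ℕ), (w.2 : ℕ)) +
        ∑ v ∈ range u with ¬ (scaleAt v = l.1 ∧ blockAt v = l.2), stepAt D v := by
    intro w
    unfold position
    rw [← Finset.sum_filter_add_sum_filter_not (range u)
      (fun v => scaleAt v = l.1 ∧ blockAt v = l.2)]
    congr 1
    · have himg : ({v ∈ range u | scaleAt v = l.1 ∧ blockAt v = l.2} : Finset ℕ) =
          (range (2 * 4 ^ (l.1 : ℕ))).image (timeOf l.1 l.2) := by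
        ext v
        simp only [mem_filter, mem_range, mem_image]
        constructor
        · rintro ⟨hv, h1, h2⟩
          have hv0 : v ≠ 0 := by
            rintro rfl
            simp [scaleAt] at h1
            omega
          refine ⟨rankAt v, ?_, ?_⟩
          · rw [← h1]; exact Nat.mod_lt _ (by positivity)
          · rw [← h1, ← h2]; exact timeOf_scaleAt hv0
        · rintro ⟨r, hr, rfl⟩
          exact ⟨(timeOf_lt hr).trans_le hu, scaleAt_timeOf _ _ _, blockAt_timeOf hr⟩
      rw [himg, sum_image (timeOf_injective _ _).injOn]
      rw [← sum_moveAt (w := ((w.1 : ℕ), (w.2 : ℕ))) (M := 4 ^ (l.1 : ℕ)) w.1.2.le w.2.2.le]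
      refine sum_congr rfl fun r hr => ?_
      unfold stepAt
      rw [blockAt_timeOf (mem_range.1 hr), scaleAt_timeOf, rankAt_timeOf (mem_range.1 hr),
        displacement_update_self]
    · refine sum_congr rfl fun v hv => ?_
      unfold stepAt
      rw [displacement_update_of_ne _ _ _ (mem_filter.1 hv).2]
  intro w w' h
  simp only [key] at h
  have := add_right_cancel h
  rw [Prod.mk.injEq] at this
  exact Prod.ext (Fin.ext this.1) (Fin.ext this.2)

/-- The bound on the probability of a given position after `k` steps. -/
def spread (k : ℕ) : ℝ := 1 / 16 ^ (Nat.log 8 k - 1)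

/-- The exponent comes from `16 = 8 ^ (4 / 3)`: a block of scale `i` has `16 ^ i` displacements,
against a time of order `8 ^ i`. The factor `256 = 16 ^ 2` pays for `k < 8 ^ (i + 2)`. -/
theorem spread_le (k : ℕ) (hk : k ≠ 0) : spread k ≤ 256 * (1 / (k : ℝ) ^ (4 / 3 : ℝ)) := by
  have hlt : k < 8 ^ (Nat.log 8 k - 1 + 2) :=
    (Nat.lt_pow_succ_log_self (by norm_num) k).trans_le
      (Nat.pow_le_pow_right (by norm_num) (by omega))
  set i := Nat.log 8 k - 1 with hi
  have h16 : ((8 : ℝ) ^ (i + 2)) ^ (4 / 3 : ℝ) = 16 ^ (i + 2) := by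
    rw [← Real.rpow_natCast, ← Real.rpow_mul (by norm_num), mul_comm, Real.rpow_mul (by norm_num),
      Real.rpow_natCast]
    congr 1
    rw [show (8 : ℝ) = 2 ^ (3 : ℝ) by norm_num, ← Real.rpow_mul (by norm_num)]
    norm_num
  have hk0 : (0 : ℝ) < k := by exact_mod_cast Nat.pos_of_ne_zero hk
  have hle : (k : ℝ) ^ (4 / 3 : ℝ) ≤ 16 ^ (i + 2) := by
    rw [← h16]
    exact Real.rpow_le_rpow hk0.le (by exact_mod_cast hlt.le) (by norm_num)
  unfold spread
  rw [← hi, mul_one_div, div_le_div_iff₀ (by positivity) (by positivity), one_mul]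
  calc (k : ℝ) ^ (4 / 3 : ℝ) ≤ 16 ^ (i + 2) := hle
    _ = 256 * 16 ^ i := by ring

/-- Summability holds since `4 / 3 > 1`. Two transverse coordinates are essential: one alone would
give the exponent `2 / 3`. -/
theorem exists_sum_spread_le : ∃ M : ℝ, 0 < M ∧ ∀ L, ∑ k ∈ range L, spread k ≤ M := by
  have hsum : Summable fun k : ℕ => 256 * (1 / (k : ℝ) ^ (4 / 3 : ℝ)) :=
    (Real.summable_one_div_nat_rpow.2 (by norm_num)).mul_left _
  -- The extra 1 covers `k = 0`, where `spread` is 1 but the summand of the series is 0.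
  refine ⟨1 + ∑' k : ℕ, 256 * (1 / (k : ℝ) ^ (4 / 3 : ℝ)), ?_, fun L => ?_⟩
  · have : 0 ≤ ∑' k : ℕ, 256 * (1 / (k : ℝ) ^ (4 / 3 : ℝ)) := tsum_nonneg fun k => by positivity
    linarith
  · calc ∑ k ∈ range L, spread k
        ≤ ∑ k ∈ range L, ((if k = 0 then 1 else 0) + 256 * (1 / (k : ℝ) ^ (4 / 3 : ℝ))) := by
          refine sum_le_sum fun k _ => ?_
          rcases eq_or_ne k 0 with rfl | hk
          · have : (0 : ℝ) ≤ 256 * (1 / ((0 : ℕ) : ℝ) ^ (4 / 3 : ℝ)) := by positivity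
            simp only [if_true]
            refine le_add_of_le_of_nonneg ?_ this
            simp [spread]
          · rw [if_neg hk, zero_add]; exact spread_le k hk
      _ ≤ _ := by
          rw [sum_add_distrib]
          refine add_le_add ?_ (hsum.sum_le_tsum _ fun k _ => by positivity)
          rw [Finset.sum_ite_eq']
          split_ifs <;> norm_num

/-- A gap of length at least `8 ^ (i + 1)`, twice the window length of scale `i`, contains a full
window. Its displacement is invisible up to time `t` and fully visible at time `u`. -/
theorem exists_label {L u t : ℕ} (hu : u < L) (ht : t ≤ u) :
    ∃ l : Fin L × Fin L, 1 ≤ Fintype.card (Fin (4 ^ (l.1 : ℕ)) × Fin (4 ^ (l.1 : ℕ))) *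
        spread (u - t) ∧
      (∀ D : Displacements L, ∀ w, ∀ r ≤ t,
        position (Function.update D l w) r = position D r) ∧
      ∀ D : Displacements L, Function.Injective fun w => position (Function.update D l w) u := by
  have hcard : ∀ i : ℕ, (Fintype.card (Fin (4 ^ i) × Fin (4 ^ i)) : ℝ) = 16 ^ i := by
    intro i
    rw [Fintype.card_prod, Fintype.card_fin, Nat.cast_mul, Nat.cast_pow, ← mul_pow]
    norm_num
  by_cases hi : Nat.log 8 (u - t) - 1 = 0
  · have hL : 0 < L := by omega
    -- For short gaps `spread` is 1 and the trivial displacement of scale 0 serves.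
    have : Subsingleton (Fin (4 ^ 0) × Fin (4 ^ 0)) := by
      rw [pow_zero]; infer_instance
    refine ⟨(⟨0, hL⟩, ⟨0, hL⟩), ?_, ?_, ?_⟩
    · rw [hcard, spread, hi]; norm_num
    · intro D w r _
      rw [show w = D (⟨0, hL⟩, ⟨0, hL⟩) from this.elim _ _, Function.update_eq_self]
    · intro D w w' _
      exact this.elim _ _
  · set i := Nat.log 8 (u - t) - 1 with hidef
    have hpow : 8 ^ (i + 1) ≤ u - t := by
      have : u - t ≠ 0 := by
        intro h; rw [h] at hidef; simp at hidef; omega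
      calc 8 ^ (i + 1) ≤ 8 ^ Nat.log 8 (u - t) := Nat.pow_le_pow_right (by norm_num) (by omega)
        _ ≤ u - t := Nat.pow_log_le_self 8 this
    have h8 : 0 < 4 * 8 ^ i := by positivity
    -- The first window that opens after the one containing `t`.
    set b := t / (4 * 8 ^ i) + 1 with hb
    have hb1 : t ≤ 4 * 8 ^ i * b := by
      rw [hb, mul_comm]
      exact (Nat.lt_div_mul_add h8).le.trans (by rw [add_mul, one_mul])
    have hb2 : 4 * 8 ^ i * (b + 1) ≤ u := by
      have := Nat.div_mul_le_self t (4 * 8 ^ i)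
      have e : 4 * 8 ^ i * (b + 1) = t / (4 * 8 ^ i) * (4 * 8 ^ i) + 8 ^ (i + 1) := by
        rw [hb, pow_succ]; ring
      omega
    have hbL : b < L := by nlinarith
    have hiL : i < L := by
      have h1 : i < 8 ^ i := Nat.lt_pow_self (by norm_num)
      have h2 : 8 ^ i ≤ 8 ^ (i + 1) := Nat.pow_le_pow_right (by norm_num) (by omega)
      omega
    refine ⟨(⟨i, hiL⟩, ⟨b, hbL⟩), ?_, ?_, ?_⟩
    · rw [hcard, spread, ← hidef]
      simp
    · intro D w r hr
      exact position_update_of_le D _ (Nat.one_le_iff_ne_zero.2 hi) w (hr.trans hb1)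
    · intro D
      exact position_update_injective D _ (Nat.one_le_iff_ne_zero.2 hi) hb2

open Classical in
/-- There is a random monotone path in the plane whose number of coincidences with any other
path has a generating function close to 1, uniformly in the length. -/
theorem exists_unpredictable_paths : ∃ M : ℝ, 0 < M ∧ ∀ L : ℕ,
    ∃ (I : Type) (_ : Fintype I) (_ : Nonempty I) (f : I → ℕ → ℕ × ℕ),
      (∀ D, f D 0 = 0) ∧
      (∀ D u, f D (u + 1) = f D u ∨ f D (u + 1) = f D u + (1, 0) ∨
        f D (u + 1) = f D u + (0, 1)) ∧
      ∀ (g : ℕ → ℕ × ℕ) (s : ℝ), 0 ≤ s → s * M ≤ 1 / 2 →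
        ∑ D, (1 + s) ^ #{u ∈ range L | f D u = g u} ≤ Fintype.card I * (1 + 2 * (s * M)) := by
  obtain ⟨M, hM0, hM⟩ := exists_sum_spread_le
  refine ⟨M, hM0, fun L => ⟨Displacements L, inferInstance, inferInstance, position, ?_, ?_, ?_⟩⟩
  · intro D; simp [position]
  · intro D u
    have : position D (u + 1) = position D u + stepAt D u := sum_range_succ _ _
    rw [this]
    rcases stepAt_cases D u with h | h | h <;> simp [h]
  · intro g s hs hsM
    convert sum_pow_card_coincidences_le position g L spread s M
      (fun k => by unfold spread; positivity) hs hsM (hM L) fun u hu t ht => ?_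
    convert exists_label hu ht

end RandomPath

/-! ### Hilbert–Schmidt and operator norms -/

section HilbertSchmidt

variable {m : ℕ}

/-- The squared Hilbert–Schmidt norm. -/
def hsSq (M : Matrix (Fin m) (Fin m) ℂ) : ℝ := ∑ i, ∑ j, ‖M i j‖ ^ 2

theorem hsSq_nonneg (M : Matrix (Fin m) (Fin m) ℂ) : 0 ≤ hsSq M :=
  Finset.sum_nonneg fun _ _ => Finset.sum_nonneg fun _ _ => by positivity

theorem hsSq_eq_trace (M : Matrix (Fin m) (Fin m) ℂ) :
    hsSq M = (Matrix.trace (M * M.conjTranspose)).re := by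
  simp only [hsSq, Matrix.trace, Matrix.diag_apply, Matrix.mul_apply, Complex.re_sum,
    Matrix.conjTranspose_apply]
  refine Finset.sum_congr rfl fun i _ => Finset.sum_congr rfl fun j _ => ?_
  rw [RCLike.star_def, Complex.mul_conj, Complex.ofReal_re, Complex.normSq_eq_norm_sq]

theorem hsSq_add_le (M N : Matrix (Fin m) (Fin m) ℂ) :
    hsSq (M + N) ≤ 2 * hsSq M + 2 * hsSq N := by
  simp only [hsSq, Finset.mul_sum, ← Finset.sum_add_distrib]
  refine Finset.sum_le_sum fun i _ => Finset.sum_le_sum fun j _ => ?_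
  rw [Matrix.add_apply]
  have h := norm_add_le (M i j) (N i j)
  nlinarith [sq_nonneg (‖M i j‖ - ‖N i j‖), norm_nonneg (M i j + N i j)]

theorem hsSq_sub_comm (M N : Matrix (Fin m) (Fin m) ℂ) : hsSq (M - N) = hsSq (N - M) := by
  simp only [hsSq, Matrix.sub_apply, norm_sub_rev]

theorem hsSq_sub (M N : Matrix (Fin m) (Fin m) ℂ) :
    hsSq (M - N) = hsSq M + hsSq N - 2 * (Matrix.trace (M * N.conjTranspose)).re := by
  have h : (Matrix.trace (N * M.conjTranspose)).re = (Matrix.trace (M * N.conjTranspose)).re := by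
    have := Matrix.trace_conjTranspose (M * N.conjTranspose)
    rw [Matrix.conjTranspose_mul, Matrix.conjTranspose_conjTranspose] at this
    rw [this, RCLike.star_def, Complex.conj_re]
  simp only [hsSq_eq_trace, Matrix.conjTranspose_sub, sub_mul, mul_sub, Matrix.trace_sub,
    Complex.sub_re]
  rw [h]; ring

theorem continuous_hsSq : Continuous (hsSq : Matrix (Fin m) (Fin m) ℂ → ℝ) := by
  unfold hsSq
  refine continuous_finsetSum _ fun i _ => continuous_finsetSum _ fun j _ => ?_
  have : Continuous fun M : Matrix (Fin m) (Fin m) ℂ => M i j := continuous_apply_apply i j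
  fun_prop

open Matrix.Norms.L2Operator in
theorem norm_sq_le_hsSq (M : Matrix (Fin m) (Fin m) ℂ) : ‖M‖ ^ 2 ≤ hsSq M := by
  have h : ‖M‖ ≤ √(hsSq M) := by
    rw [← Matrix.l2_opNorm_toEuclideanCLM]
    refine ContinuousLinearMap.opNorm_le_bound _ (Real.sqrt_nonneg _) fun x => ?_
    rw [EuclideanSpace.norm_eq, EuclideanSpace.norm_eq, ← Real.sqrt_mul (hsSq_nonneg M)]
    refine Real.sqrt_le_sqrt ?_
    rw [hsSq, Finset.sum_mul]
    refine Finset.sum_le_sum fun i _ => ?_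
    have e : (Matrix.toEuclideanCLM (n := Fin m) (𝕜 := ℂ) M x) i = ∑ j, M i j * x j := rfl
    rw [e]
    calc ‖∑ j, M i j * x j‖ ^ 2 ≤ (∑ j, ‖M i j‖ * ‖x j‖) ^ 2 := by
          refine pow_le_pow_left₀ (norm_nonneg _) ?_ 2
          exact (norm_sum_le _ _).trans (Finset.sum_le_sum fun j _ => (norm_mul _ _).le)
      _ ≤ _ := Finset.sum_mul_sq_le_sq_mul_sq _ _ _
  calc ‖M‖ ^ 2 ≤ √(hsSq M) ^ 2 := pow_le_pow_left₀ (norm_nonneg _) h 2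
    _ = hsSq M := Real.sq_sqrt (hsSq_nonneg M)

open Matrix.Norms.L2Operator in
theorem norm_entry_le (M : Matrix (Fin m) (Fin m) ℂ) (i j : Fin m) : ‖M i j‖ ≤ ‖M‖ := by
  have h := M.l2_opNorm_mulVec (EuclideanSpace.single j (1 : ℂ))
  rw [PiLp.norm_single, norm_one, mul_one] at h
  refine le_trans ?_ h
  refine le_trans (le_of_eq ?_) (PiLp.norm_apply_le _ i)
  simp

open Matrix.Norms.L2Operator in
theorem abs_re_trace_le (M : Matrix (Fin m) (Fin m) ℂ) : |(Matrix.trace M).re| ≤ m * ‖M‖ := by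
  calc |(Matrix.trace M).re| ≤ ‖Matrix.trace M‖ := Complex.abs_re_le_norm _
    _ ≤ ∑ i, ‖M i i‖ := norm_sum_le _ _
    _ ≤ ∑ _i : Fin m, ‖M‖ := Finset.sum_le_sum fun i _ => norm_entry_le M i i
    _ = m * ‖M‖ := by simp

end HilbertSchmidt

/-! ### The matrix group and its Haar measure -/

section Group

variable {m : ℕ} {G : Subgroup (Matrix.unitaryGroup (Fin m) ℂ)}

/-- The matrix of an element of `G`. -/
def mat (g : G) : Matrix (Fin m) (Fin m) ℂ :=
  ((g : Matrix.unitaryGroup (Fin m) ℂ) : Matrix (Fin m) (Fin m) ℂ)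

@[simp] theorem mat_one : mat (1 : G) = 1 := rfl

@[simp] theorem mat_mul (g h : G) : mat (g * h) = mat g * mat h := rfl

theorem mat_inv (g : G) : mat g⁻¹ = (mat g).conjTranspose := rfl

@[simp] theorem mat_mul_mat_inv (g : G) : mat g * mat g⁻¹ = 1 := by
  rw [← mat_mul, mul_inv_cancel, mat_one]

@[simp] theorem mat_inv_mul_mat (g : G) : mat g⁻¹ * mat g = 1 := by
  rw [← mat_mul, inv_mul_cancel, mat_one]

theorem conjTranspose_mat (g : G) : (mat g).conjTranspose = mat g⁻¹ := rfl

@[fun_prop]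
theorem continuous_mat : Continuous (mat : G → Matrix (Fin m) (Fin m) ℂ) :=
  continuous_subtype_val.comp continuous_subtype_val

theorem reTr_eq (g : G) : reTr g = (Matrix.trace (mat g)).re := rfl

@[fun_prop]
theorem continuous_reTr : Continuous (reTr : G → ℝ) := by
  have : Continuous fun g : G => (Matrix.trace (mat g)).re :=
    Complex.continuous_re.comp continuous_mat.matrix_trace
  exact this

theorem reTr_inv (g : G) : reTr g⁻¹ = reTr g := by
  rw [reTr_eq, reTr_eq, mat_inv, Matrix.trace_conjTranspose, RCLike.star_def, Complex.conj_re]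

theorem reTr_mul_comm (g h : G) : reTr (g * h) = reTr (h * g) := by
  rw [reTr_eq, reTr_eq, mat_mul, mat_mul, Matrix.trace_mul_comm]

theorem reTr_conj (g h : G) : reTr (h * g * h⁻¹) = reTr g := by
  rw [reTr_mul_comm, inv_mul_cancel_left]

theorem hsSq_mat_mul (g : G) (M : Matrix (Fin m) (Fin m) ℂ) : hsSq (mat g * M) = hsSq M := by
  rw [hsSq_eq_trace, hsSq_eq_trace, Matrix.conjTranspose_mul, conjTranspose_mat, mul_assoc,
    Matrix.trace_mul_comm, mul_assoc, mul_assoc, mat_inv_mul_mat, mul_one]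

theorem hsSq_mul_mat (g : G) (M : Matrix (Fin m) (Fin m) ℂ) : hsSq (M * mat g) = hsSq M := by
  rw [hsSq_eq_trace, hsSq_eq_trace, Matrix.conjTranspose_mul, conjTranspose_mat, mul_assoc,
    ← mul_assoc (mat g), mat_mul_mat_inv, one_mul]

theorem hsSq_mat (g : G) : hsSq (mat g) = m := by
  rw [hsSq_eq_trace, conjTranspose_mat, mat_mul_mat_inv]
  simp

/-- This identity translates between spin correlations and squared distances, where a triangle
inequality is available. -/
theorem hsSq_mat_sub_mat (g h : G) : hsSq (mat g - mat h) = 2 * m - 2 * reTr (g⁻¹ * h) := by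
  rw [hsSq_sub, hsSq_mat, hsSq_mat, conjTranspose_mat, ← mat_mul, ← reTr_eq, reTr_mul_comm,
    ← reTr_inv (h⁻¹ * g), mul_inv_rev, inv_inv]
  ring

theorem reTr_le (g : G) : reTr g ≤ m := by
  have h := hsSq_nonneg (mat (1 : G) - mat g)
  rw [hsSq_mat_sub_mat, inv_one, one_mul] at h
  linarith

theorem neg_le_reTr (g : G) : -(m : ℝ) ≤ reTr g := by
  have h := hsSq_nonneg (mat (1 : G) + mat g)
  have e : hsSq (mat (1 : G) + mat g) = 2 * m + 2 * reTr g := by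
    rw [← sub_neg_eq_add, hsSq_sub, hsSq_mat]
    have : hsSq (-mat g) = m := by
      rw [← hsSq_mat g]; simp [hsSq]
    rw [this, mat_one, one_mul, Matrix.conjTranspose_neg, Matrix.trace_neg, conjTranspose_mat,
      Complex.neg_re, ← reTr_eq, reTr_inv]
    ring
  linarith

open Matrix.Norms.L2Operator in
theorem norm_mat_le_one (g : G) : ‖mat g‖ ≤ 1 := by
  rcases Nat.eq_zero_or_pos m with rfl | hm
  · rw [Subsingleton.elim (mat g) 0, norm_zero]; exact zero_le_one
  · have : Nonempty (Fin m) := ⟨⟨0, hm⟩⟩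
    exact (CStarRing.norm_coe_unitary (g : Matrix.unitaryGroup (Fin m) ℂ)).le

instance : SecondCountableTopology G :=
  haveI : SecondCountableTopology (Matrix (Fin m) (Fin m) ℂ) :=
    inferInstanceAs (SecondCountableTopology (Fin m → Fin m → ℂ))
  haveI : SecondCountableTopology (Matrix.unitaryGroup (Fin m) ℂ) :=
    TopologicalSpace.Subtype.secondCountableTopology _
  TopologicalSpace.Subtype.secondCountableTopology _

variable (G) [CompactSpace G]

instance : (haarProb G).IsHaarMeasure := by unfold haarProb; infer_instance

instance : IsProbabilityMeasure (haarProb G) :=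
  ⟨by simpa [haarProb] using
    Measure.haarMeasure_self (K₀ := (⊤ : TopologicalSpace.PositiveCompacts G))⟩

variable {G} in
-- Uniqueness of Haar measure; applied to right translates and to the inverse measure, it gives the
-- two remaining invariances.
theorem eq_haarProb_of_isMulLeftInvariant (ν : Measure G) [IsProbabilityMeasure ν]
    [ν.IsMulLeftInvariant] : ν = haarProb G := by
  have h := Measure.isMulInvariant_eq_smul_of_compactSpace ν (haarProb G)
  have h1 := congrArg (fun μ : Measure G => μ Set.univ) h
  simp only [measure_univ, Measure.smul_apply] at h1
  rw [ENNReal.smul_def, smul_eq_mul, mul_one] at h1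
  rw [h, ENNReal.coe_eq_one.1 h1.symm, one_smul]

instance : (haarProb G).IsMulRightInvariant := by
  constructor
  intro g
  have : IsProbabilityMeasure ((haarProb G).map (· * g)) :=
    Measure.isProbabilityMeasure_map (by fun_prop)
  exact eq_haarProb_of_isMulLeftInvariant _

instance : (haarProb G).IsInvInvariant := by
  constructor
  have : IsProbabilityMeasure (haarProb G).inv :=
    Measure.isProbabilityMeasure_map (by fun_prop)
  exact eq_haarProb_of_isMulLeftInvariant _

end Group

/-! ### Integrability on compact spaces -/

section Compact

/-- A continuous function on a compact space is integrable for every finite measure. -/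
theorem Continuous.integrable_of_compactSpace {X E : Type*} [TopologicalSpace X] [CompactSpace X]
    [MeasurableSpace X] [OpensMeasurableSpace X] [NormedAddCommGroup E]
    [SecondCountableTopologyEither X E] {μ : Measure X} [IsFiniteMeasure μ] {f : X → E}
    (hf : Continuous f) : Integrable f μ := by
  obtain ⟨C, hC⟩ := (isCompact_range hf).isBounded.exists_norm_le
  exact Integrable.of_bound hf.aestronglyMeasurable C
    (Filter.Eventually.of_forall fun x => hC _ ⟨x, rfl⟩)

end Compact

/-! ### The law of the disorder on one edge -/

section EdgeLaw

variable {m : ℕ} (G : Subgroup (Matrix.unitaryGroup (Fin m) ℂ)) [CompactSpace G]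

instance (u : ℝ) : IsProbabilityMeasure (edgeLaw G u) :=
  isProbabilityMeasure_tilted (Continuous.integrable_of_compactSpace (by fun_prop))

variable {G} in
-- The density is a class function and Haar measure is invariant on both sides.
theorem integral_edgeLaw_conj {E : Type*} [NormedAddCommGroup E] [NormedSpace ℝ E] (u : ℝ)
    (f : G → E) (h : G) :
    ∫ g, f (h * g * h⁻¹) ∂(edgeLaw G u) = ∫ g, f g ∂(edgeLaw G u) := by
  unfold edgeLaw
  rw [integral_tilted, integral_tilted]
  have e : ∀ g : G, (Real.exp (u * reTr g) / ∫ x, Real.exp (u * reTr x) ∂(haarProb G)) •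
      f (h * g * h⁻¹) = (fun g => (Real.exp (u * reTr g) /
        ∫ x, Real.exp (u * reTr x) ∂(haarProb G)) • f g) (h * g * h⁻¹) := by
    intro g
    simp only [reTr_conj]
  simp only [e]
  have e1 := integral_mul_left_eq_self (μ := haarProb G)
    (fun g => (fun g => (Real.exp (u * reTr g) /
        ∫ x, Real.exp (u * reTr x) ∂(haarProb G)) • f g) (g * h⁻¹)) h
  rw [e1]
  exact integral_mul_right_eq_self (μ := haarProb G)
    (fun g => (Real.exp (u * reTr g) /
        ∫ x, Real.exp (u * reTr x) ∂(haarProb G)) • f g) h⁻¹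

variable {G} in
theorem integral_edgeLaw_inv {E : Type*} [NormedAddCommGroup E] [NormedSpace ℝ E] (u : ℝ)
    (f : G → E) :
    ∫ g, f g⁻¹ ∂(edgeLaw G u) = ∫ g, f g ∂(edgeLaw G u) := by
  unfold edgeLaw
  rw [integral_tilted, integral_tilted,
    ← integral_inv_eq_self (fun g => (Real.exp (u * reTr g) /
        ∫ x, Real.exp (u * reTr x) ∂(haarProb G)) • f g)]
  simp only [reTr_inv]

/-- The Haar measure of a neighbourhood of the identity is at least polynomial in its radius. -/
theorem one_le_card_mul_haarProb_ball (n : ℕ) (hn : 1 ≤ n) :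
    1 ≤ ((2 * n + 1) ^ 2) ^ (m * m) *
      (haarProb G).real {g : G | m - reTr g ≤ (m : ℝ) ^ 2 / n ^ 2} := by
  set B : Set G := {g : G | m - reTr g ≤ (m : ℝ) ^ 2 / n ^ 2} with hB
  -- Pigeonhole: the entries are rounded to a grid of mesh `1 / n`. Each nonempty cell, translated
  -- by the inverse of one of its points, lands in `B`, and there are at most `T.card` cells.
  set φ : G → (Fin m × Fin m → ℤ × ℤ) := fun g ij =>
    (⌊n * (mat g ij.1 ij.2).re⌋, ⌊n * (mat g ij.1 ij.2).im⌋) with hφ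
  have hn0 : (0 : ℝ) < n := by exact_mod_cast hn
  set T : Finset (Fin m × Fin m → ℤ × ℤ) :=
    Fintype.piFinset fun _ => Finset.Icc (-(n : ℤ)) n ×ˢ Finset.Icc (-(n : ℤ)) n with hT
  have hTcard : (T.card : ℝ) = ((2 * n + 1) ^ 2) ^ (m * m) := by
    rw [hT, Fintype.card_piFinset]
    simp only [Finset.card_product, Int.card_Icc, Finset.prod_const, Finset.card_univ,
      Fintype.card_prod, Fintype.card_fin]
    have : ((n : ℤ) + 1 - -(n : ℤ)).toNat = 2 * n + 1 := by omega
    rw [this]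
    push_cast
    ring
  have hfloor : ∀ a : ℝ, |a| ≤ 1 → ⌊n * a⌋ ∈ Finset.Icc (-(n : ℤ)) n := by
    intro a ha
    rw [Finset.mem_Icc]
    have ha' := abs_le.1 ha
    constructor
    · rw [Int.le_floor]; push_cast; nlinarith
    · have : (⌊n * a⌋ : ℝ) ≤ n := (Int.floor_le _).trans (by nlinarith)
      exact_mod_cast this
  have hφT : ∀ g, φ g ∈ T := by
    intro g
    rw [hT, Fintype.mem_piFinset]
    intro ij
    have hent : ‖mat g ij.1 ij.2‖ ≤ 1 :=
      entry_norm_bound_of_unitary (g : Matrix.unitaryGroup (Fin m) ℂ).2 _ _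
    exact Finset.mem_product.2 ⟨hfloor _ ((Complex.abs_re_le_norm _).trans hent),
      hfloor _ ((Complex.abs_im_le_norm _).trans hent)⟩
  have hcell : ∀ c, (haarProb G).real {g | φ g = c} ≤ (haarProb G).real B := by
    intro c
    by_cases hne : ∃ g0, φ g0 = c
    · obtain ⟨g0, hg0⟩ := hne
      have hsub : {g | φ g = c} ⊆ (fun g => g0⁻¹ * g) ⁻¹' B := by
        intro g hg
        rw [Set.mem_ofPred_eq, ← hg0] at hg
        rw [Set.mem_preimage, hB, Set.mem_ofPred_eq]
        have h1 := hsSq_mat_sub_mat g0 g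
        have hclose : ∀ a b : ℝ, ⌊n * a⌋ = ⌊n * b⌋ → (a - b) ^ 2 ≤ 1 / n ^ 2 := by
          intro a b hab
          have h := Int.abs_sub_lt_one_of_floor_eq_floor hab
          rw [← mul_sub] at h
          have h' := (abs_lt.1 h)
          rw [le_div_iff₀ (by positivity), ← mul_pow]
          nlinarith
        have h2 : hsSq (mat g0 - mat g) ≤ 2 * ((m : ℝ) ^ 2 / n ^ 2) := by
          unfold hsSq
          calc ∑ i, ∑ j, ‖(mat g0 - mat g) i j‖ ^ 2
              ≤ ∑ _i : Fin m, ∑ _j : Fin m, 2 * (1 / (n : ℝ) ^ 2) := by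
                refine Finset.sum_le_sum fun i _ => Finset.sum_le_sum fun j _ => ?_
                have hij := congrFun hg (i, j)
                simp only [hφ, Prod.mk.injEq] at hij
                have hre := hclose _ _ hij.1
                have him := hclose _ _ hij.2
                rw [← Complex.normSq_eq_norm_sq, Complex.normSq_apply, Matrix.sub_apply,
                  Complex.sub_re, Complex.sub_im]
                nlinarith
            _ = _ := by simp; ring
        linarith
      calc (haarProb G).real {g | φ g = c}
          ≤ (haarProb G).real ((fun g => g0⁻¹ * g) ⁻¹' B) := measureReal_mono hsub
        _ = (haarProb G).real B := by
            rw [measureReal_def, measure_preimage_mul, measureReal_def]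
    · have : {g | φ g = c} = ∅ := by
        ext g; simp only [Set.mem_ofPred_eq, Set.mem_empty_iff_false, iff_false]
        exact fun h => hne ⟨g, h⟩
      rw [this, measureReal_empty]
      exact measureReal_nonneg
  have hcover : (Set.univ : Set G) ⊆ ⋃ c ∈ T, {g | φ g = c} := by
    intro g _
    simp only [Set.mem_iUnion, Set.mem_ofPred_eq, exists_prop]
    exact ⟨φ g, hφT g, rfl⟩
  calc (1 : ℝ) = (haarProb G).real Set.univ := by simp
    _ ≤ (haarProb G).real (⋃ c ∈ T, {g | φ g = c}) :=
        measureReal_mono hcover (measure_ne_top _ _)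
    _ ≤ ∑ c ∈ T, (haarProb G).real {g | φ g = c} := measureReal_biUnion_finset_le _ _
    _ ≤ ∑ _c ∈ T, (haarProb G).real B := Finset.sum_le_sum fun c _ => hcell c
    _ = _ := by rw [Finset.sum_const, nsmul_eq_mul, hTcard]

theorem integral_edgeLaw (u : ℝ) (f : G → ℝ) :
    ∫ g, f g ∂(edgeLaw G u) =
      (∫ g, f g * Real.exp (u * reTr g) ∂(haarProb G)) /
        ∫ g, Real.exp (u * reTr g) ∂(haarProb G) := by
  unfold edgeLaw
  rw [integral_tilted, ← integral_div]
  refine integral_congr_ae (Filter.Eventually.of_forall fun g => ?_)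
  simp only [smul_eq_mul]
  ring

theorem integral_exp_reTr_pos (u : ℝ) : 0 < ∫ g, Real.exp (u * reTr g) ∂(haarProb G) :=
  integral_exp_pos (Continuous.integrable_of_compactSpace (by fun_prop))

/-- The mean energy of an edge is of order `log β / β`. -/
theorem exists_integral_edgeLaw_le : ∃ C : ℝ, 0 < C ∧ ∀ β : ℝ, 3 ≤ β →
    ∫ g, (m - reTr g) ∂(edgeLaw G β) ≤ C * (Real.log β / β) := by
  -- The number of real coordinates of a complex matrix, hence the exponent of the volume bound.
  set κ : ℕ := 2 * (m * m) with hκ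
  set K : ℝ := 2 * m * (Real.exp 1 * (2 * m + 5) ^ κ) with hK
  have hK0 : 0 ≤ K := by positivity
  refine ⟨(κ + 1) + K, by positivity, fun β hβ => ?_⟩
  have hβ0 : 0 < β := by linarith
  have hlog : 1 ≤ Real.log β := by
    rw [Real.le_log_iff_exp_le hβ0]
    exact Real.exp_one_lt_three.le.trans hβ
  -- Chosen so that `exp (-(β * r)) * β ^ κ = 1 / β`: energies above `r` then contribute only `O(1 /
  -- β)`, despite the polynomial loss in the partition function.
  set r : ℝ := (κ + 1) * Real.log β / β with hr
  have hr0 : 0 ≤ r := by positivity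
  set Z : ℝ := ∫ g, Real.exp (β * reTr g) ∂(haarProb G) with hZ
  have hZ0 : 0 < Z := integral_exp_reTr_pos G β
  -- a lower bound on the partition function
  set n : ℕ := ⌈m * β⌉₊ + 1 with hn
  have hn1 : m * β ≤ n := by
    rw [hn]; push_cast
    linarith [Nat.le_ceil (m * β)]
  have hn2 : (n : ℝ) ≤ m * β + 2 := by
    rw [hn]; push_cast
    linarith [Nat.ceil_lt_add_one (show 0 ≤ m * β by positivity)]
  set B : Set G := {g : G | m - reTr g ≤ (m : ℝ) ^ 2 / n ^ 2} with hB
  have hball : 1 ≤ ((2 * m + 5) * β) ^ κ * (haarProb G).real B := by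
    refine (one_le_card_mul_haarProb_ball G n (by omega)).trans ?_
    refine mul_le_mul_of_nonneg_right ?_ measureReal_nonneg
    rw [← pow_mul]
    exact pow_le_pow_left₀ (by positivity) (by nlinarith) _
  have hBm : MeasurableSet B :=
    (isClosed_le (by fun_prop) continuous_const).measurableSet
  have hBZ : Real.exp (β * m - 1) * (haarProb G).real B ≤ Z := by
    calc Real.exp (β * m - 1) * (haarProb G).real B
        = ∫ g, B.indicator (fun _ => Real.exp (β * m - 1)) g ∂(haarProb G) := by
          rw [integral_indicator_const _ hBm, smul_eq_mul, mul_comm]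
      _ ≤ Z := by
          refine integral_mono ((integrable_const _).indicator hBm)
            (Continuous.integrable_of_compactSpace (by fun_prop)) fun g => ?_
          by_cases hg : g ∈ B
          · rw [Set.indicator_of_mem hg]
            refine Real.exp_le_exp.2 ?_
            have h1 : (m : ℝ) - reTr g ≤ m ^ 2 / n ^ 2 := hg
            -- On this ball the weight is within a factor `exp 1` of its maximum; `n ≥ m * β` is
            -- more than enough.
            have h2 : (m : ℝ) ^ 2 / n ^ 2 ≤ 1 / β := by
              have hn0 : (0 : ℝ) < n := by rw [hn]; positivity
              rw [div_le_div_iff₀ (by positivity) hβ0, one_mul]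
              have h3 : (m * β) ^ 2 ≤ (n : ℝ) ^ 2 := pow_le_pow_left₀ (by positivity) hn1 2
              have h4 : (m : ℝ) ^ 2 * β ≤ (m * β) ^ 2 := by
                rw [mul_pow]
                exact mul_le_mul_of_nonneg_left (by nlinarith) (by positivity)
              linarith
            have h5 : β * (m - reTr g) ≤ β * (1 / β) :=
              mul_le_mul_of_nonneg_left (h1.trans h2) hβ0.le
            rw [mul_one_div_cancel hβ0.ne'] at h5
            linarith
          · rw [Set.indicator_of_notMem hg]
            positivity
  have hmass : Real.exp (β * m) ≤ Real.exp 1 * ((2 * m + 5) * β) ^ κ * Z := by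
    have e : Real.exp (β * m) = Real.exp 1 * Real.exp (β * m - 1) := by
      rw [← Real.exp_add]; congr 1; ring
    rw [e, mul_assoc]
    refine mul_le_mul_of_nonneg_left ?_ (Real.exp_pos _).le
    calc Real.exp (β * m - 1) ≤ Real.exp (β * m - 1) *
          (((2 * m + 5) * β) ^ κ * (haarProb G).real B) :=
          le_mul_of_one_le_right (Real.exp_pos _).le hball
      _ = ((2 * m + 5) * β) ^ κ * (Real.exp (β * m - 1) * (haarProb G).real B) := by ring
      _ ≤ _ := mul_le_mul_of_nonneg_left hBZ (by positivity)
  have hexpr : Real.exp (-(β * r)) * β ^ κ = 1 / β := by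
    have : β * r = Real.log (β ^ (κ + 1)) := by
      rw [hr, Real.log_pow, mul_div_cancel₀ _ hβ0.ne']; push_cast; ring
    rw [this, Real.exp_neg, Real.exp_log (by positivity), pow_succ]
    field_simp
  have hpt : ∀ g : G, (m - reTr g) * Real.exp (β * reTr g) ≤
      r * Real.exp (β * reTr g) + 2 * m * Real.exp (-(β * r)) * Real.exp (β * m) := by
    intro g
    rcases le_total ((m : ℝ) - reTr g) r with h | h
    · have := mul_le_mul_of_nonneg_right h (Real.exp_pos (β * reTr g)).le
      have : 0 ≤ 2 * m * Real.exp (-(β * r)) * Real.exp (β * m) := by positivity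
      linarith
    · have h1 : (m : ℝ) - reTr g ≤ 2 * m := by linarith [neg_le_reTr g]
      have h2 : Real.exp (β * reTr g) ≤ Real.exp (-(β * r)) * Real.exp (β * m) := by
        rw [← Real.exp_add]
        exact Real.exp_le_exp.2 (by nlinarith)
      have h3 := mul_le_mul h1 h2 (Real.exp_pos _).le (by positivity)
      have : 0 ≤ r * Real.exp (β * reTr g) := by positivity
      linarith
  rw [integral_edgeLaw, ← hZ, div_le_iff₀ hZ0]
  calc ∫ g, (m - reTr g) * Real.exp (β * reTr g) ∂(haarProb G)
      ≤ ∫ g, (r * Real.exp (β * reTr g) + 2 * m * Real.exp (-(β * r)) * Real.exp (β * m))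
          ∂(haarProb G) :=
        integral_mono (Continuous.integrable_of_compactSpace (by fun_prop))
          (Continuous.integrable_of_compactSpace (by fun_prop)) hpt
    _ = r * Z + 2 * m * Real.exp (-(β * r)) * Real.exp (β * m) := by
        rw [integral_add (Continuous.integrable_of_compactSpace (by fun_prop))
          (integrable_const _), integral_const_mul, integral_const]
        simp [hZ]
    _ ≤ r * Z + 2 * m * Real.exp (-(β * r)) *
          (Real.exp 1 * ((2 * m + 5) * β) ^ κ * Z) := by gcongr
    _ = (r + K * (Real.exp (-(β * r)) * β ^ κ)) * Z := by rw [hK, mul_pow]; ring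
    _ ≤ _ := by
        refine mul_le_mul_of_nonneg_right ?_ hZ0.le
        rw [hexpr, add_mul, hr, mul_div_assoc]
        gcongr

open Matrix.Norms.L2Operator in
/-- The mean of the disorder on an edge. -/
def edgeMean (u : ℝ) : Matrix (Fin m) (Fin m) ℂ := ∫ g, mat g ∂(edgeLaw G u)

open Matrix.Norms.L2Operator in
-- Conjugation invariance of the law. For a general `G` the mean need not be scalar, but commuting
-- with `G` is all that gauge equivariance needs.
theorem edgeMean_comm (u : ℝ) (h : G) : mat h * edgeMean G u = edgeMean G u * mat h := by
  have hint : Integrable (fun g : G => mat g) (edgeLaw G u) :=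
    Continuous.integrable_of_compactSpace (by fun_prop)
  have e1 := integral_edgeLaw_conj u (fun g : G => mat g) h
  have e2 : mat h * edgeMean G u * mat h⁻¹ = edgeMean G u := by
    unfold edgeMean
    rw [← integral_const_mul_of_integrable hint, ← integral_mul_const_of_integrable]
    · exact e1
    · exact hint.const_mul _
  calc mat h * edgeMean G u = mat h * edgeMean G u * mat h⁻¹ * mat h := by
        rw [mul_assoc _ _ (mat h), mat_inv_mul_mat, mul_one]
    _ = edgeMean G u * mat h := by rw [e2]

open Matrix.Norms.L2Operator in
theorem edgeMean_inv (u : ℝ) : ∫ g : G, mat g⁻¹ ∂(edgeLaw G u) = edgeMean G u :=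
  integral_edgeLaw_inv u (fun g : G => mat g)

open Matrix.Norms.L2Operator in
theorem conjTranspose_edgeMean (u : ℝ) : (edgeMean G u).conjTranspose = edgeMean G u := by
  conv_rhs => rw [← edgeMean_inv]
  exact ((starL' ℝ : Matrix (Fin m) (Fin m) ℂ ≃L[ℝ] _).integral_comp_comm
    (fun g : G => mat g)).symm

open Matrix.Norms.L2Operator in
-- Jensen's inequality, followed by domination of the operator norm by the Hilbert–Schmidt norm.
theorem norm_one_sub_edgeMean_sq_le (u : ℝ) :
    ‖1 - edgeMean G u‖ ^ 2 ≤ 2 * ∫ g, (m - reTr g) ∂(edgeLaw G u) := by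
  have hc : Continuous fun g : G => ‖1 - mat g‖ :=
    (continuous_const.sub continuous_mat).norm
  have hc2 : Continuous fun g : G => ‖1 - mat g‖ ^ 2 := hc.pow 2
  have h1 : ‖1 - edgeMean G u‖ ≤ ∫ g : G, ‖1 - mat g‖ ∂(edgeLaw G u) := by
    have : 1 - edgeMean G u = ∫ g : G, (1 - mat g) ∂(edgeLaw G u) := by
      rw [integral_sub (integrable_const _)
        (Continuous.integrable_of_compactSpace (by fun_prop)), integral_const]
      simp [edgeMean]
    rw [this]
    exact norm_integral_le_integral_norm _
  set c := ∫ g : G, ‖1 - mat g‖ ∂(edgeLaw G u) with hcdef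
  have h2 : c ^ 2 ≤ ∫ g : G, ‖1 - mat g‖ ^ 2 ∂(edgeLaw G u) := by
    have h3 : 0 ≤ ∫ g : G, (‖1 - mat g‖ - c) ^ 2 ∂(edgeLaw G u) :=
      integral_nonneg fun g => sq_nonneg _
    have e : ∀ g : G, (‖1 - mat g‖ - c) ^ 2 = ‖1 - mat g‖ ^ 2 + (c ^ 2 - 2 * c * ‖1 - mat g‖) :=
      fun g => by ring
    simp only [e] at h3
    rw [integral_add (Continuous.integrable_of_compactSpace hc2)
      (Continuous.integrable_of_compactSpace (by fun_prop)),
      integral_sub (integrable_const _) (Continuous.integrable_of_compactSpace (by fun_prop)),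
      integral_const_mul, integral_const, ← hcdef] at h3
    simp only [probReal_univ, one_smul] at h3
    nlinarith
  calc ‖1 - edgeMean G u‖ ^ 2 ≤ c ^ 2 := pow_le_pow_left₀ (norm_nonneg _) h1 2
    _ ≤ ∫ g : G, ‖1 - mat g‖ ^ 2 ∂(edgeLaw G u) := h2
    _ ≤ ∫ g : G, 2 * (m - reTr g) ∂(edgeLaw G u) := by
        refine integral_mono (Continuous.integrable_of_compactSpace hc2)
          (Continuous.integrable_of_compactSpace (by fun_prop)) fun g => ?_
        refine (norm_sq_le_hsSq _).trans (le_of_eq ?_)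
        have := hsSq_mat_sub_mat (1 : G) g
        rw [mat_one, inv_one, one_mul] at this
        rw [this]; ring
    _ = _ := integral_const_mul _ _

open Matrix.Norms.L2Operator in
-- A Neumann series argument. The inverse inherits commutation and self-adjointness from the mean,
-- and serves to normalize the disorder to mean 1.
theorem exists_edgeMean_inverse (u : ℝ) (η : ℝ) (hη : ‖1 - edgeMean G u‖ ≤ η) (hη1 : η < 1) :
    ∃ B : Matrix (Fin m) (Fin m) ℂ, B * edgeMean G u = 1 ∧ edgeMean G u * B = 1 ∧
      (∀ h : G, mat h * B = B * mat h) ∧ B.conjTranspose = B ∧ ‖B‖ ≤ (1 - η)⁻¹ := by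
  set A := edgeMean G u with hA
  have hunit : IsUnit A := by
    have := isUnit_one_sub_of_norm_lt_one (x := 1 - A) (hη.trans_lt hη1)
    rwa [sub_sub_cancel] at this
  obtain ⟨w, hw⟩ := hunit
  have h1 : (↑w⁻¹ : Matrix (Fin m) (Fin m) ℂ) * A = 1 := by rw [← hw]; simp
  have h2 : A * (↑w⁻¹ : Matrix (Fin m) (Fin m) ℂ) = 1 := by rw [← hw]; simp
  set B : Matrix (Fin m) (Fin m) ℂ := ↑w⁻¹ with hB
  refine ⟨B, h1, h2, fun h => ?_, ?_, ?_⟩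
  · calc mat h * B = B * A * (mat h * B) := by rw [h1, one_mul]
      _ = B * (mat h * A) * B := by rw [edgeMean_comm, ← hA]; simp only [mul_assoc]
      _ = B * mat h := by simp only [mul_assoc, h2, mul_one]
  · have h3 : A * B.conjTranspose = 1 := by
      have := congrArg Matrix.conjTranspose h1
      rwa [Matrix.conjTranspose_mul, hA, conjTranspose_edgeMean, Matrix.conjTranspose_one] at this
    calc B.conjTranspose = B * A * B.conjTranspose := by rw [h1, one_mul]
      _ = B := by rw [mul_assoc, h3, mul_one]
  · have h4 : ‖B‖ ≤ 1 + ‖B‖ * η := by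
      calc ‖B‖ = ‖1 + B * (1 - A)‖ := by rw [mul_sub, h1, mul_one, add_sub_cancel]
        _ ≤ ‖(1 : Matrix (Fin m) (Fin m) ℂ)‖ + ‖B * (1 - A)‖ := norm_add_le _ _
        _ ≤ 1 + ‖B‖ * η := add_le_add (norm_mat_le_one (1 : G))
            ((norm_mul_le _ _).trans (mul_le_mul_of_nonneg_left hη (norm_nonneg _)))
    rw [← one_div, le_div_iff₀ (by linarith)]
    linarith

end EdgeLaw

/-! ### Orientation of lattice edges -/

section Lattice

variable {d : ℕ}

/-- Adjacent points differ in a single coordinate, so the reference orientation reaches every edge.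
-/
theorem lt_or_lt_of_adj {x y : Fin d → ℤ} (h : (latticeGraph d).Adj x y) : x < y ∨ y < x := by
  have hsum : ∑ k, |x k - y k| = 1 := h
  have hne : x ≠ y := h.ne
  by_contra hcon
  push Not at hcon
  have h1 : ¬ x ≤ y := fun hle => hcon.1 (lt_of_le_of_ne hle hne)
  have h2 : ¬ y ≤ x := fun hle => hcon.2 (lt_of_le_of_ne hle hne.symm)
  rw [Pi.le_def] at h1 h2
  push Not at h1 h2
  obtain ⟨k, hk⟩ := h1
  obtain ⟨l, hl⟩ := h2
  have hkl : k ≠ l := by rintro rfl; omega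
  have hle : ∑ j ∈ {k, l}, |x j - y j| ≤ ∑ j, |x j - y j| :=
    Finset.sum_le_sum_of_subset_of_nonneg (Finset.subset_univ _) fun _ _ _ => abs_nonneg _
  rw [hsum, Finset.sum_pair hkl] at hle
  have hk' : 1 ≤ |x k - y k| := Int.one_le_abs (by omega)
  have hl' : 1 ≤ |x l - y l| := Int.one_le_abs (by omega)
  omega

end Lattice

/-! ### Gauge transformations -/

section Gauge

variable {m : ℕ} {G : Subgroup (Matrix.unitaryGroup (Fin m) ℂ)} {d : ℕ} {Λ : Finset (Fin d → ℤ)}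

/-- The action of a gauge transformation on the disorder. -/
def gauge (V : Λ → G) (ω : PosEdge Λ → G) : PosEdge Λ → G :=
  fun e => V e.1.1 * ω e * (V e.1.2)⁻¹

theorem orientedDisorder_gauge (V : Λ → G) (ω : PosEdge Λ → G) {i j : Λ}
    (h : (latticeGraph d).Adj i j) :
    orientedDisorder (gauge V ω) i j = V i * orientedDisorder ω i j * (V j)⁻¹ := by
  unfold orientedDisorder
  split_ifs with h1 h2
  · rfl
  · simp [gauge, mul_assoc]
  · rcases lt_or_lt_of_adj h with h3 | h3
    · exact absurd ⟨h, h3⟩ h1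
    · exact absurd ⟨h.symm, h3⟩ h2

theorem orientedDisorder_swap (ω : PosEdge Λ → G) (i j : Λ) :
    orientedDisorder ω j i = (orientedDisorder ω i j)⁻¹ := by
  unfold orientedDisorder
  by_cases h1 : (latticeGraph d).Adj i j ∧ (i : Fin d → ℤ) < j
  · rw [dif_pos h1, dif_neg fun h => lt_asymm h.2 h1.2, dif_pos h1]
  · by_cases h2 : (latticeGraph d).Adj j i ∧ (j : Fin d → ℤ) < i
    · rw [dif_pos h2, dif_neg h1, dif_pos h2, inv_inv]
    · rw [dif_neg h2, dif_neg h1, dif_neg h1, dif_neg h2, inv_one]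

theorem orientedDisorder_of_posEdge (ω : PosEdge Λ → G) (e : PosEdge Λ) :
    orientedDisorder ω e.1.1 e.1.2 = ω e := by
  unfold orientedDisorder
  rw [dif_pos e.2]

@[fun_prop]
theorem continuous_orientedDisorder (i j : Λ) :
    Continuous fun ω : PosEdge Λ → G => orientedDisorder ω i j := by
  unfold orientedDisorder
  split_ifs <;> fun_prop

open Classical in
theorem interaction_gauge (V : Λ → G) (ω : PosEdge Λ → G) (U : Λ → G) :
    interaction (gauge V ω) (V * U) = interaction ω U := by
  unfold interaction
  congr 1
  refine Finset.sum_congr rfl fun e he => ?_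
  rw [orientedDisorder_gauge V ω (Finset.mem_filter.1 he).2]
  congr 1
  simp only [Pi.mul_apply]
  group

open Classical in
-- The two orientations of an edge contribute equally, which cancels the factor one half.
theorem interaction_one (ω : PosEdge Λ → G) : interaction ω 1 = ∑ e, reTr (ω e) := by
  unfold interaction
  set f : Λ × Λ → ℝ := fun e => reTr (orientedDisorder ω e.1 e.2) with hf
  have hf0 : ∀ e : Λ × Λ, reTr (((1 : Λ → G) e.1)⁻¹ * orientedDisorder ω e.1 e.2 *
      (1 : Λ → G) e.2) = f e := by
    intro e; simp [hf]
  have hswap : ∀ e : Λ × Λ, f e.swap = f e := by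
    intro e
    simp only [hf, Prod.fst_swap, Prod.snd_swap]
    rw [orientedDisorder_swap, reTr_inv]
  simp only [hf0]
  have e1 : ∑ e : Λ × Λ with (latticeGraph d).Adj e.1 e.2, f e =
      ∑ e : Λ × Λ with ((latticeGraph d).Adj e.1 e.2 ∧ (e.1 : Fin d → ℤ) < e.2), f e +
      ∑ e : Λ × Λ with ((latticeGraph d).Adj e.1 e.2 ∧ (e.2 : Fin d → ℤ) < e.1), f e := by
    rw [← Finset.sum_union]
    · refine Finset.sum_congr ?_ fun _ _ => rfl
      ext e
      simp only [Finset.mem_filter, Finset.mem_univ, true_and, Finset.mem_union]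
      constructor
      · intro h
        exact (lt_or_lt_of_adj h).imp (fun h' => ⟨h, h'⟩) fun h' => ⟨h, h'⟩
      · rintro (h | h) <;> exact h.1
    · rw [Finset.disjoint_left]
      intro e h1 h2
      exact lt_asymm (Finset.mem_filter.1 h1).2.2 (Finset.mem_filter.1 h2).2.2
  have e2 : ∑ e : Λ × Λ with ((latticeGraph d).Adj e.1 e.2 ∧ (e.2 : Fin d → ℤ) < e.1), f e =
      ∑ e : Λ × Λ with ((latticeGraph d).Adj e.1 e.2 ∧ (e.1 : Fin d → ℤ) < e.2), f e := by
    refine Finset.sum_bij' (fun e _ => e.swap) (fun e _ => e.swap) ?_ ?_ (by simp) (by simp)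
      fun e _ => (hswap e).symm
    all_goals
      intro e he
      have := Finset.mem_filter.1 he
      exact Finset.mem_filter.2 ⟨Finset.mem_univ _, this.2.1.symm, this.2.2⟩
  have e3 : ∑ e : Λ × Λ with ((latticeGraph d).Adj e.1 e.2 ∧ (e.1 : Fin d → ℤ) < e.2), f e =
      ∑ e : PosEdge Λ, f e.1 :=
    Finset.sum_subtype _ (fun e => by simp) f
  rw [e1, e2, e3, ← two_mul, ← mul_assoc, one_div, inv_mul_cancel₀ two_ne_zero, one_mul]
  refine Finset.sum_congr rfl fun e _ => ?_
  simp only [hf, orientedDisorder_of_posEdge]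

theorem continuous_interaction :
    Continuous fun p : (PosEdge Λ → G) × (Λ → G) => interaction p.1 p.2 := by
  unfold interaction
  refine continuous_const.mul (continuous_finsetSum _ fun e _ => continuous_reTr.comp ?_)
  have := (continuous_orientedDisorder (G := G) e.1 e.2).comp
    (continuous_fst (X := PosEdge Λ → G) (Y := Λ → G))
  simp only [Function.comp_def] at this
  fun_prop

theorem continuous_exp_interaction (β : ℝ) :
    Continuous (Function.uncurry fun (ω : PosEdge Λ → G) (U : Λ → G) =>
      Real.exp (β * interaction ω U)) :=
  Real.continuous_exp.comp (continuous_const.mul continuous_interaction)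

theorem exp_interaction_gauge (β : ℝ) (V U : Λ → G) (ω : PosEdge Λ → G) :
    Real.exp (β * interaction (gauge V ω) (V * U)) = Real.exp (β * interaction ω U) := by
  rw [interaction_gauge]

end Gauge

/-! ### The Nishimori identity -/

section Measures

theorem continuous_of_uncurry {X Y Z : Type*} [TopologicalSpace X] [TopologicalSpace Y]
    [TopologicalSpace Z] {F : X → Y → Z} (hF : Continuous (Function.uncurry F)) (x : X) :
    Continuous (F x) := hF.comp (Continuous.prodMk_right x)

theorem pi_tilted {ι : Type*} [Fintype ι] {α : ι → Type*} [∀ i, MeasurableSpace (α i)]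
    (μ : ∀ i, Measure (α i)) [∀ i, IsProbabilityMeasure (μ i)] (f : ∀ i, α i → ℝ)
    (hf : ∀ i, Integrable (fun x => Real.exp (f i x)) (μ i)) :
    Measure.pi (fun i => (μ i).tilted (f i)) =
      (Measure.pi μ).tilted (fun x => ∑ i, f i (x i)) := by
  have hprob : ∀ i, IsProbabilityMeasure ((μ i).tilted (f i)) :=
    fun i => isProbabilityMeasure_tilted (hf i)
  refine Measure.pi_eq fun s hs => ?_
  rw [tilted_apply_eq_ofReal_integral' _ (MeasurableSet.univ_pi hs)]
  simp only [tilted_apply_eq_ofReal_integral' _ (hs _)]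
  rw [← ENNReal.ofReal_prod_of_nonneg
    (fun i _ => integral_nonneg fun x => by positivity), Measure.restrict_pi_pi]
  congr 1
  simp only [Real.exp_sum]
  rw [integral_div, integral_fintype_prod_eq_prod (μ := μ) (fun i x => Real.exp (f i x)),
    integral_fintype_prod_eq_prod (μ := fun i => (μ i).restrict (s i))
      (fun i x => Real.exp (f i x))]
  simp only [integral_div, Finset.prod_div_distrib]

variable {m : ℕ} (G : Subgroup (Matrix.unitaryGroup (Fin m) ℂ)) [CompactSpace G] {d : ℕ}
  (Λ : Finset (Fin d → ℤ))

/-- The product of Haar measures over the edges. -/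
def edgeHaar : Measure (PosEdge Λ → G) := Measure.pi fun _ => haarProb G

instance : IsProbabilityMeasure (edgeHaar G Λ) := by unfold edgeHaar; infer_instance

instance (u : ℝ) : IsProbabilityMeasure (disorderLaw G Λ u) := by
  unfold disorderLaw; infer_instance

open Classical in
instance (bd : Finset (Fin d → ℤ)) : IsProbabilityMeasure (spinMeasure G Λ bd) := by
  unfold spinMeasure
  have : ∀ i : Λ, IsProbabilityMeasure
      (if (i : Fin d → ℤ) ∈ bd then Measure.dirac 1 else haarProb G) := by
    intro i
    split_ifs <;> infer_instance
  infer_instance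

/-- With `u = β` the density is the Gibbs weight at the trivial configuration: this defines the
Nishimori line. -/
theorem disorderLaw_eq_tilted (u : ℝ) :
    disorderLaw G Λ u = (edgeHaar G Λ).tilted fun ω => u * interaction ω 1 := by
  unfold disorderLaw edgeLaw edgeHaar
  rw [pi_tilted]
  · simp only [interaction_one, Finset.mul_sum]
  · exact fun _ => Continuous.integrable_of_compactSpace (by fun_prop)

variable {G Λ}

theorem measurePreserving_gauge (V : Λ → G) :
    MeasurePreserving (gauge V) (edgeHaar G Λ) (edgeHaar G Λ) := by
  refine measurePreserving_pi _ _ (f := fun (e : PosEdge Λ) (g : G) => V e.1.1 * g * (V e.1.2)⁻¹)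
    fun e => ?_
  exact (measurePreserving_mul_right (haarProb G) (V e.1.2)⁻¹).comp
    (measurePreserving_mul_left (haarProb G) (V e.1.1))

open Classical in
theorem measurePreserving_spin_mul {bd : Finset (Fin d → ℤ)} (V : Λ → G)
    (hV : ∀ i : Λ, (i : Fin d → ℤ) ∈ bd → V i = 1) :
    MeasurePreserving (fun U => V * U) (spinMeasure G Λ bd) (spinMeasure G Λ bd) := by
  have hsf : ∀ i : Λ, SigmaFinite
      (if (i : Fin d → ℤ) ∈ bd then Measure.dirac (1 : G) else haarProb G) := by
    intro i
    split_ifs <;> infer_instance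
  refine measurePreserving_pi _ _ (f := fun (i : Λ) (g : G) => V i * g) fun i => ?_
  split_ifs with h
  · rw [hV i h]
    simp only [one_mul]
    exact MeasurePreserving.id (Measure.dirac (1 : G))
  · exact measurePreserving_mul_left (haarProb G) (V i)

open Classical in
theorem ae_spinMeasure_eq_one (bd : Finset (Fin d → ℤ)) :
    ∀ᵐ U ∂(spinMeasure G Λ bd), ∀ i : Λ, (i : Fin d → ℤ) ∈ bd → U i = 1 := by
  have hsf : ∀ i : Λ, SigmaFinite
      (if (i : Fin d → ℤ) ∈ bd then Measure.dirac (1 : G) else haarProb G) := by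
    intro i
    split_ifs <;> infer_instance
  rw [ae_all_iff]
  intro i
  by_cases h : (i : Fin d → ℤ) ∈ bd
  · have h1 : ∀ᵐ g ∂(if (i : Fin d → ℤ) ∈ bd then Measure.dirac (1 : G) else haarProb G),
        g = 1 := by
      rw [if_pos h, ae_dirac_eq]
      exact Filter.eventually_pure.2 rfl
    have h2 : ∀ᵐ U ∂(spinMeasure G Λ bd), U i = 1 :=
      (Measure.tendsto_eval_ae_ae (μ := fun i : Λ => if (i : Fin d → ℤ) ∈ bd then
        Measure.dirac (1 : G) else haarProb G) (i := i)).eventually h1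
    filter_upwards [h2] with U hU _ using hU
  · exact Filter.Eventually.of_forall fun U h' => absurd h' h

/-- Gauge-invariant observables do not see the spins once the disorder is averaged over Haar
measure. -/
theorem integral_edgeHaar_of_gaugeInvariant (bd : Finset (Fin d → ℤ))
    (F : (PosEdge Λ → G) → (Λ → G) → ℝ) (hF : Continuous (Function.uncurry F))
    (hinv : ∀ V U ω, (∀ i : Λ, (i : Fin d → ℤ) ∈ bd → V i = 1) →
      F (gauge V ω) (V * U) = F ω U) :
    ∫ ω, ∫ U, F ω U ∂(spinMeasure G Λ bd) ∂(edgeHaar G Λ) = ∫ ω, F ω 1 ∂(edgeHaar G Λ) := by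
  rw [integral_integral_swap (Continuous.integrable_of_compactSpace hF)]
  have h : ∀ᵐ U ∂(spinMeasure G Λ bd),
      ∫ ω, F ω U ∂(edgeHaar G Λ) = ∫ ω, F ω 1 ∂(edgeHaar G Λ) := by
    filter_upwards [ae_spinMeasure_eq_one bd] with U hU
    have hc : Continuous fun ω => F ω U := hF.comp (Continuous.prodMk_left U)
    -- The disorder is gauged by the spin configuration itself, which moves the spins to 1. This is
    -- allowed because almost every `U` is 1 on `bd`.
    conv_lhs => rw [← (measurePreserving_gauge U).map_eq]
    rw [integral_map (measurePreserving_gauge U).measurable.aemeasurable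
      hc.aestronglyMeasurable]
    refine integral_congr_ae (Filter.Eventually.of_forall fun ω => ?_)
    have := hinv U 1 ω hU
    rw [mul_one] at this
    exact this
  rw [integral_congr_ae h, integral_const]
  simp

theorem continuous_integral_spin (bd : Finset (Fin d → ℤ))
    (F : (PosEdge Λ → G) → (Λ → G) → ℝ) (hF : Continuous (Function.uncurry F)) :
    Continuous fun ω => ∫ U, F ω U ∂(spinMeasure G Λ bd) := by
  simpa using continuous_parametric_integral_of_continuous (μ := spinMeasure G Λ bd) hF
    isCompact_univ

theorem integral_gibbs (β : ℝ) (bd : Finset (Fin d → ℤ)) (ω : PosEdge Λ → G)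
    (f : (Λ → G) → ℝ) :
    ∫ U, f U ∂(gibbs β bd ω) = (∫ U, f U * Real.exp (β * interaction ω U) ∂(spinMeasure G Λ bd)) /
      ∫ U, Real.exp (β * interaction ω U) ∂(spinMeasure G Λ bd) := by
  unfold gibbs
  rw [integral_tilted, ← integral_div]
  refine integral_congr_ae (Filter.Eventually.of_forall fun g => ?_)
  simp only [smul_eq_mul]
  ring

theorem integral_disorderLaw (β : ℝ) (f : (PosEdge Λ → G) → ℝ) :
    ∫ ω, f ω ∂(disorderLaw G Λ β) =
      (∫ ω, f ω * Real.exp (β * interaction ω 1) ∂(edgeHaar G Λ)) /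
      ∫ ω, Real.exp (β * interaction ω 1) ∂(edgeHaar G Λ) := by
  rw [disorderLaw_eq_tilted, integral_tilted, ← integral_div]
  refine integral_congr_ae (Filter.Eventually.of_forall fun g => ?_)
  simp only [smul_eq_mul]
  ring

theorem integral_exp_interaction_pos (β : ℝ) (bd : Finset (Fin d → ℤ)) (ω : PosEdge Λ → G) :
    0 < ∫ U, Real.exp (β * interaction ω U) ∂(spinMeasure G Λ bd) :=
  integral_exp_pos (Continuous.integrable_of_compactSpace
    (continuous_of_uncurry (continuous_exp_interaction β) ω))

theorem continuous_integral_gibbs (β : ℝ) (bd : Finset (Fin d → ℤ))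
    (g : (PosEdge Λ → G) → (Λ → G) → ℝ) (hg : Continuous (Function.uncurry g)) :
    Continuous fun ω => ∫ U, g ω U ∂(gibbs β bd ω) := by
  simp only [integral_gibbs]
  exact (continuous_integral_spin bd _ (hg.mul (continuous_exp_interaction β))).div
    (continuous_integral_spin bd _ (continuous_exp_interaction β))
    fun ω => (integral_exp_interaction_pos β bd ω).ne'

theorem integral_spin_mul {bd : Finset (Fin d → ℤ)} (V : Λ → G)
    (hV : ∀ i : Λ, (i : Fin d → ℤ) ∈ bd → V i = 1) (f : (Λ → G) → ℝ) (hf : Continuous f) :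
    ∫ U, f (V * U) ∂(spinMeasure G Λ bd) = ∫ U, f U ∂(spinMeasure G Λ bd) := by
  conv_rhs => rw [← (measurePreserving_spin_mul V hV).map_eq]
  rw [integral_map (measurePreserving_spin_mul V hV).measurable.aemeasurable
    hf.aestronglyMeasurable]

/-- With `B` the quenched average of `g`, both `B * w` and `g * w` are gauge invariant. Spins are
reintroduced on each side, and the integrals over the spins agree for each disorder. -/
theorem integral_mul_weight_eq (bd : Finset (Fin d → ℤ))
    (g w : (PosEdge Λ → G) → (Λ → G) → ℝ) (B : (PosEdge Λ → G) → ℝ)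
    (hg : Continuous (Function.uncurry g)) (hw : Continuous (Function.uncurry w))
    (hB : Continuous B)
    (hginv : ∀ V U ω, (∀ i : Λ, (i : Fin d → ℤ) ∈ bd → V i = 1) →
      g (gauge V ω) (V * U) = g ω U)
    (hwinv : ∀ V U ω, w (gauge V ω) (V * U) = w ω U)
    (hBinv : ∀ V ω, (∀ i : Λ, (i : Fin d → ℤ) ∈ bd → V i = 1) → B (gauge V ω) = B ω)
    (hav : ∀ ω, B ω * ∫ U, w ω U ∂(spinMeasure G Λ bd) =
      ∫ U, g ω U * w ω U ∂(spinMeasure G Λ bd)) :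
    ∫ ω, B ω * w ω 1 ∂(edgeHaar G Λ) = ∫ ω, g ω 1 * w ω 1 ∂(edgeHaar G Λ) := by
  have h1 : Continuous (Function.uncurry fun ω U => B ω * w ω U) :=
    (hB.comp continuous_fst).mul hw
  have h2 : Continuous (Function.uncurry fun ω U => g ω U * w ω U) := hg.mul hw
  rw [← integral_edgeHaar_of_gaugeInvariant bd (fun ω U => B ω * w ω U) h1
      fun V U ω hV => by rw [hBinv V ω hV, hwinv],
    ← integral_edgeHaar_of_gaugeInvariant bd (fun ω U => g ω U * w ω U) h2
      fun V U ω hV => by rw [hginv V U ω hV, hwinv]]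
  refine integral_congr_ae (Filter.Eventually.of_forall fun ω => ?_)
  simp only
  rw [integral_const_mul, hav]

theorem integral_gibbs_gauge (β : ℝ) (bd : Finset (Fin d → ℤ))
    (g : (PosEdge Λ → G) → (Λ → G) → ℝ) (hg : Continuous (Function.uncurry g))
    (hinv : ∀ V U ω, (∀ i : Λ, (i : Fin d → ℤ) ∈ bd → V i = 1) →
      g (gauge V ω) (V * U) = g ω U) (V : Λ → G) (ω : PosEdge Λ → G)
    (hV : ∀ i : Λ, (i : Fin d → ℤ) ∈ bd → V i = 1) :
    ∫ U, g (gauge V ω) U ∂(gibbs β bd (gauge V ω)) = ∫ U, g ω U ∂(gibbs β bd ω) := by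
  rw [integral_gibbs, integral_gibbs]
  have hc2 : Continuous fun U => Real.exp (β * interaction (gauge V ω) U) :=
    continuous_of_uncurry (continuous_exp_interaction β) _
  have hc1 : Continuous fun U => g (gauge V ω) U * Real.exp (β * interaction (gauge V ω) U) :=
    (continuous_of_uncurry hg _).mul hc2
  rw [← integral_spin_mul V hV _ hc1, ← integral_spin_mul V hV _ hc2]
  simp only [exp_interaction_gauge, hinv V _ ω hV]

/-- The Nishimori identity: on the Nishimori line, the expectation of a gauge-invariant
observable of the spins and the disorder is its mean at the trivial configuration. -/
theorem nishimori_identity (β : ℝ) (bd : Finset (Fin d → ℤ))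
    (g : (PosEdge Λ → G) → (Λ → G) → ℝ) (hg : Continuous (Function.uncurry g))
    (hinv : ∀ V U ω, (∀ i : Λ, (i : Fin d → ℤ) ∈ bd → V i = 1) →
      g (gauge V ω) (V * U) = g ω U) :
    ∫ ω, ∫ U, g ω U ∂(gibbs β bd ω) ∂(disorderLaw G Λ β) =
      ∫ ω, g ω 1 ∂(disorderLaw G Λ β) := by
  rw [integral_disorderLaw, integral_disorderLaw]
  refine congrArg (· / _) (integral_mul_weight_eq bd g
    (fun ω U => Real.exp (β * interaction ω U)) (fun ω => ∫ U, g ω U ∂(gibbs β bd ω)) hg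
    (continuous_exp_interaction β) (continuous_integral_gibbs β bd g hg) hinv
    (exp_interaction_gauge β) (integral_gibbs_gauge β bd g hg hinv) fun ω => ?_)
  rw [integral_gibbs]
  exact div_mul_cancel₀ _ (integral_exp_interaction_pos β bd ω).ne'

end Measures

/-! ### Resampling one coordinate of a product measure -/

section Update

theorem measurePreserving_update {ι : Type*} [Fintype ι] [DecidableEq ι] {α : ι → Type*}
    [∀ i, MeasurableSpace (α i)] (μ : ∀ i, Measure (α i)) [∀ i, IsProbabilityMeasure (μ i)]
    (e : ι) :
    MeasurePreserving (fun p : (∀ i, α i) × α e => Function.update p.1 e p.2)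
      ((Measure.pi μ).prod (μ e)) (Measure.pi μ) := by
  have hm : Measurable fun p : (∀ i, α i) × α e => Function.update p.1 e p.2 := by
    refine measurable_pi_iff.2 fun i => ?_
    by_cases h : i = e
    · subst h; simpa using measurable_snd
    · simp only [Function.update_of_ne h]
      exact (measurable_pi_apply i).comp measurable_fst
  refine ⟨hm, (Measure.pi_eq fun s hs => ?_).symm⟩
  have hpre : (fun p : (∀ i, α i) × α e => Function.update p.1 e p.2) ⁻¹' Set.univ.pi s =
      (Set.univ.pi (Function.update s e Set.univ)) ×ˢ s e := by
    ext ⟨x, y⟩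
    simp only [Set.mem_preimage, Set.mem_pi, Set.mem_univ, true_imp_iff, Set.mem_prod]
    constructor
    · intro h
      refine ⟨fun i => ?_, by simpa using h e⟩
      by_cases hi : i = e
      · subst hi; simp
      · simpa [Function.update_of_ne hi] using h i
    · rintro ⟨h1, h2⟩ i
      by_cases hi : i = e
      · subst hi; simpa using h2
      · simpa [Function.update_of_ne hi] using h1 i
  rw [Measure.map_apply hm (MeasurableSet.univ_pi hs), hpre, Measure.prod_prod, Measure.pi_pi,
    ← Finset.mul_prod_erase _ (fun i => μ i (s i)) (Finset.mem_univ e),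
    ← Finset.mul_prod_erase _ _ (Finset.mem_univ e), Function.update_self, measure_univ, one_mul,
    mul_comm]
  congr 1
  refine Finset.prod_congr rfl fun i hi => ?_
  rw [Function.update_of_ne (Finset.ne_of_mem_erase hi)]

end Update

/-! ### Products of disorder along words -/

section Words

variable {m : ℕ} {G : Subgroup (Matrix.unitaryGroup (Fin m) ℂ)} {d : ℕ} {Λ : Finset (Fin d → ℤ)}

open Classical in
/-- The normalized disorder along the step from `p.1` to `p.2`: the identity for a pair that is
not an edge. -/
def letter (B : Matrix (Fin m) (Fin m) ℂ) (ω : PosEdge Λ → G) (p : Λ × Λ) :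
    Matrix (Fin m) (Fin m) ℂ :=
  if (latticeGraph d).Adj p.1 p.2 then B * mat (orientedDisorder ω p.1 p.2) else 1

/-- The unoriented pair underlying a step. -/
def stepKey (p : Λ × Λ) : Sym2 Λ := s(p.1, p.2)

theorem stepKey_swap (p : Λ × Λ) : stepKey p.swap = stepKey p := Sym2.eq_swap

/-- The ordered product of the normalized disorder along a list of steps. -/
def wordProd (B : Matrix (Fin m) (Fin m) ℂ) (ω : PosEdge Λ → G) (L : List (Λ × Λ)) :
    Matrix (Fin m) (Fin m) ℂ := (L.map (letter B ω)).prod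

theorem wordProd_append (B : Matrix (Fin m) (Fin m) ℂ) (ω : PosEdge Λ → G)
    (L L' : List (Λ × Λ)) : wordProd B ω (L ++ L') = wordProd B ω L * wordProd B ω L' := by
  simp [wordProd]

theorem wordProd_cons (B : Matrix (Fin m) (Fin m) ℂ) (ω : PosEdge Λ → G)
    (p : Λ × Λ) (L : List (Λ × Λ)) : wordProd B ω (p :: L) = letter B ω p * wordProd B ω L := by
  simp [wordProd]

theorem continuous_letter (B : Matrix (Fin m) (Fin m) ℂ) (p : Λ × Λ) :
    Continuous fun ω : PosEdge Λ → G => letter B ω p := by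
  unfold letter
  split_ifs
  · exact continuous_const.mul (continuous_mat.comp (continuous_orientedDisorder _ _))
  · exact continuous_const

@[fun_prop]
theorem continuous_wordProd (B : Matrix (Fin m) (Fin m) ℂ) (L : List (Λ × Λ)) :
    Continuous fun ω : PosEdge Λ → G => wordProd B ω L := by
  unfold wordProd
  exact continuous_list_prod L fun p _ => continuous_letter B p

open Matrix.Norms.L2Operator in
theorem norm_letter_le {B : Matrix (Fin m) (Fin m) ℂ} {c : ℝ} (hc : 1 ≤ c) (hB : ‖B‖ ≤ c)
    (ω : PosEdge Λ → G) (p : Λ × Λ) : ‖letter B ω p‖ ≤ c := by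
  unfold letter
  split_ifs
  · calc ‖B * mat (orientedDisorder ω p.1 p.2)‖
        ≤ ‖B‖ * ‖mat (orientedDisorder ω p.1 p.2)‖ := norm_mul_le _ _
      _ ≤ c * 1 := mul_le_mul hB (norm_mat_le_one _) (norm_nonneg _) (by linarith)
      _ = c := mul_one c
  · exact (norm_mat_le_one (1 : G)).trans hc

open Matrix.Norms.L2Operator in
theorem norm_wordProd_le {B : Matrix (Fin m) (Fin m) ℂ} {c : ℝ} (hc : 1 ≤ c) (hB : ‖B‖ ≤ c)
    (ω : PosEdge Λ → G) (L : List (Λ × Λ)) : ‖wordProd B ω L‖ ≤ c ^ L.length := by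
  induction L with
  | nil => simpa [wordProd] using norm_mat_le_one (1 : G)
  | cons p L ih =>
    rw [wordProd_cons, List.length_cons, pow_succ']
    exact (norm_mul_le _ _).trans
      (mul_le_mul (norm_letter_le hc hB ω p) ih (norm_nonneg _) (by linarith))

theorem conjTranspose_letter {B : Matrix (Fin m) (Fin m) ℂ} (hBG : ∀ h : G, mat h * B = B * mat h)
    (hBs : B.conjTranspose = B) (ω : PosEdge Λ → G) (p : Λ × Λ) :
    (letter B ω p).conjTranspose = letter B ω p.swap := by
  unfold letter
  by_cases h : (latticeGraph d).Adj p.1 p.2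
  · rw [if_pos h, if_pos (show (latticeGraph d).Adj p.swap.1 p.swap.2 from h.symm),
      Matrix.conjTranspose_mul, hBs, conjTranspose_mat, hBG, Prod.fst_swap, Prod.snd_swap,
      orientedDisorder_swap, inv_inv]
  · rw [if_neg h, if_neg (fun h' : (latticeGraph d).Adj p.swap.1 p.swap.2 => h h'.symm),
      Matrix.conjTranspose_one]

/-- Adjoints of words are again words, so a correlation of two words is the mean of a single
concatenated word. -/
theorem conjTranspose_wordProd {B : Matrix (Fin m) (Fin m) ℂ}
    (hBG : ∀ h : G, mat h * B = B * mat h) (hBs : B.conjTranspose = B) (ω : PosEdge Λ → G)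
    (L : List (Λ × Λ)) :
    (wordProd B ω L).conjTranspose = wordProd B ω (L.map Prod.swap).reverse := by
  unfold wordProd
  rw [Matrix.conjTranspose_list_prod, List.map_map, List.map_reverse, List.map_map]
  congr 3
  funext p
  exact conjTranspose_letter hBG hBs ω p

theorem letter_gauge {B : Matrix (Fin m) (Fin m) ℂ} (hBG : ∀ h : G, mat h * B = B * mat h)
    (V : Λ → G) (ω : PosEdge Λ → G) {i j : Λ} (h : i = j ∨ (latticeGraph d).Adj i j) :
    letter B (gauge V ω) (i, j) = mat (V i) * letter B ω (i, j) * mat (V j)⁻¹ := by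
  unfold letter
  by_cases hadj : (latticeGraph d).Adj i j
  · rw [if_pos hadj, if_pos hadj]
    simp only
    rw [orientedDisorder_gauge V ω hadj, mat_mul, mat_mul, ← mul_assoc (mat (V i)), hBG]
    simp only [mul_assoc]
  · rw [if_neg hadj, if_neg hadj]
    obtain rfl := h.resolve_right hadj
    rw [mul_one, mat_mul_mat_inv]

open Classical in
theorem orientedDisorder_update_of_ne (ω : PosEdge Λ → G) (e : PosEdge Λ) (g : G) {i j : Λ}
    (h : s(i, j) ≠ s(e.1.1, e.1.2)) :
    orientedDisorder (Function.update ω e g) i j = orientedDisorder ω i j := by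
  unfold orientedDisorder
  split_ifs with h1 h2
  · rw [Function.update_of_ne]
    rintro rfl
    exact h rfl
  · rw [Function.update_of_ne]
    rintro rfl
    exact h Sym2.eq_swap
  · rfl

open Classical in
theorem letter_update_of_ne (B : Matrix (Fin m) (Fin m) ℂ) (ω : PosEdge Λ → G) (e : PosEdge Λ)
    (g : G) {p : Λ × Λ} (h : stepKey p ≠ s(e.1.1, e.1.2)) :
    letter B (Function.update ω e g) p = letter B ω p := by
  unfold letter
  rw [orientedDisorder_update_of_ne ω e g h]

open Classical in
theorem wordProd_update_of_notMem (B : Matrix (Fin m) (Fin m) ℂ) (ω : PosEdge Λ → G)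
    (e : PosEdge Λ) (g : G) (L : List (Λ × Λ)) (h : s(e.1.1, e.1.2) ∉ L.map stepKey) :
    wordProd B (Function.update ω e g) L = wordProd B ω L := by
  unfold wordProd
  congr 1
  refine List.map_congr_left fun p hp => letter_update_of_ne B ω e g fun h' => h ?_
  rw [← h']
  exact List.mem_map_of_mem hp

theorem exists_posEdge {p : Λ × Λ} (h : (latticeGraph d).Adj p.1 p.2) :
    ∃ e : PosEdge Λ, stepKey p = s(e.1.1, e.1.2) := by
  rcases lt_or_lt_of_adj h with h' | h'
  · exact ⟨⟨p, h, h'⟩, rfl⟩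
  · exact ⟨⟨p.swap, h.symm, h'⟩, Sym2.eq_swap⟩

variable [CompactSpace G]

open Classical Matrix.Norms.L2Operator in
theorem integral_letter_update {B : Matrix (Fin m) (Fin m) ℂ} {u : ℝ} (hBA : B * edgeMean G u = 1)
    (ω : PosEdge Λ → G) (e : PosEdge Λ) {p : Λ × Λ} (h : stepKey p = s(e.1.1, e.1.2)) :
    ∫ g, letter B (Function.update ω e g) p ∂(edgeLaw G u) = 1 := by
  have hint : Integrable (fun g : G => mat g) (edgeLaw G u) :=
    Continuous.integrable_of_compactSpace (by fun_prop)
  have hint' : Integrable (fun g : G => mat g⁻¹) (edgeLaw G u) :=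
    Continuous.integrable_of_compactSpace (by fun_prop)
  rcases Sym2.eq_iff.1 h with ⟨h1, h2⟩ | ⟨h1, h2⟩
  · have e1 : ∀ g, letter B (Function.update ω e g) p = B * mat g := by
      intro g
      unfold letter
      rw [h1, h2, if_pos e.2.1, orientedDisorder_of_posEdge, Function.update_self]
    simp only [e1]
    rw [integral_const_mul_of_integrable hint]
    exact hBA
  · have e1 : ∀ g, letter B (Function.update ω e g) p = B * mat g⁻¹ := by
      intro g
      unfold letter
      rw [h1, h2, if_pos e.2.1.symm, orientedDisorder_swap, orientedDisorder_of_posEdge,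
        Function.update_self]
    simp only [e1]
    rw [integral_const_mul_of_integrable hint', edgeMean_inv]
    exact hBA

open Classical Matrix.Norms.L2Operator in
theorem integral_disorderLaw_update (u : ℝ) (e : PosEdge Λ)
    (F : (PosEdge Λ → G) → Matrix (Fin m) (Fin m) ℂ) (hF : Continuous F) :
    ∫ ω, F ω ∂(disorderLaw G Λ u) =
      ∫ ω, ∫ g, F (Function.update ω e g) ∂(edgeLaw G u) ∂(disorderLaw G Λ u) := by
  have hmp := measurePreserving_update (fun _ : PosEdge Λ => edgeLaw G u) e
  have hc : Continuous fun p : (PosEdge Λ → G) × G => F (Function.update p.1 e p.2) :=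
    hF.comp (continuous_fst.update e continuous_snd)
  rw [← integral_prod (μ := disorderLaw G Λ u) (ν := edgeLaw G u)
    (fun p : (PosEdge Λ → G) × G => F (Function.update p.1 e p.2))
    (Continuous.integrable_of_compactSpace hc)]
  conv_lhs => rw [disorderLaw, ← hmp.map_eq]
  rw [integral_map hmp.measurable.aemeasurable hF.aestronglyMeasurable]
  rfl

open Matrix.Norms.L2Operator in
/-- A step whose edge does not reappear may be removed from a word under the disorder average. -/
theorem integral_wordProd_remove {B : Matrix (Fin m) (Fin m) ℂ} {u : ℝ}
    (hBA : B * edgeMean G u = 1) (L₁ L₂ : List (Λ × Λ)) (p : Λ × Λ)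
    (h1 : stepKey p ∉ L₁.map stepKey) (h2 : stepKey p ∉ L₂.map stepKey) :
    ∫ ω : PosEdge Λ → G, wordProd B ω (L₁ ++ p :: L₂) ∂(disorderLaw G Λ u) =
      ∫ ω : PosEdge Λ → G, wordProd B ω (L₁ ++ L₂) ∂(disorderLaw G Λ u) := by
  classical
  by_cases hadj : (latticeGraph d).Adj p.1 p.2
  · obtain ⟨e, he⟩ := exists_posEdge hadj
    rw [integral_disorderLaw_update u e _ (continuous_wordProd B _)]
    refine integral_congr_ae (Filter.Eventually.of_forall fun ω => ?_)
    simp only [wordProd_append, wordProd_cons]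
    have hL1 := fun g => wordProd_update_of_notMem B ω e g L₁ (he ▸ h1)
    have hL2 := fun g => wordProd_update_of_notMem B ω e g L₂ (he ▸ h2)
    simp only [hL1, hL2]
    have hint : Integrable (fun g : G => letter B (Function.update ω e g) p) (edgeLaw G u) :=
      Continuous.integrable_of_compactSpace
        ((continuous_letter B p).comp (continuous_const.update e continuous_id))
    rw [integral_const_mul_of_integrable (hint.mul_const _),
      integral_mul_const_of_integrable hint, integral_letter_update hBA ω e he, one_mul]
  · simp only [wordProd_append, wordProd_cons]
    simp [letter, hadj]

open Classical Matrix.Norms.L2Operator in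
-- Steps with key outside `S` occur once each and are integrated out one by one; steps inside `S`
-- may repeat and are kept.
theorem integral_wordProd_filter {B : Matrix (Fin m) (Fin m) ℂ} {u : ℝ}
    (hBA : B * edgeMean G u = 1) (S : Set (Sym2 Λ)) (n : ℕ) (L : List (Λ × Λ))
    (hn : L.length = n) (hL : ((L.map stepKey).filter (· ∉ S)).Nodup) :
    ∫ ω : PosEdge Λ → G, wordProd B ω L ∂(disorderLaw G Λ u) =
      ∫ ω : PosEdge Λ → G, wordProd B ω (L.filter (stepKey · ∈ S)) ∂(disorderLaw G Λ u) := by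
  induction n generalizing L with
  | zero => rw [List.length_eq_zero_iff.1 hn]; rfl
  | succ n ih =>
    by_cases hall : ∀ p ∈ L, stepKey p ∈ S
    · rw [List.filter_eq_self.2 (by simpa using hall)]
    · push Not at hall
      obtain ⟨p, hp, hpS⟩ := hall
      obtain ⟨L₁, L₂, rfl⟩ := List.append_of_mem hp
      have hnd : (((L₁ ++ L₂).map stepKey).filter (· ∉ S)).Nodup ∧
          stepKey p ∉ L₁.map stepKey ∧ stepKey p ∉ L₂.map stepKey := by
        rw [List.map_append, List.map_cons, List.filter_append,
          List.filter_cons_of_pos (by simpa using hpS), List.nodup_middle, List.nodup_cons] at hL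
        rw [List.map_append, List.filter_append]
        refine ⟨hL.2, fun h => hL.1 ?_, fun h => hL.1 ?_⟩
        · exact List.mem_append_left _ (List.mem_filter.2 ⟨h, by simpa using hpS⟩)
        · exact List.mem_append_right _ (List.mem_filter.2 ⟨h, by simpa using hpS⟩)
      rw [integral_wordProd_remove hBA L₁ L₂ p hnd.2.1 hnd.2.2,
        ih (L₁ ++ L₂) (by simp at hn ⊢; omega) hnd.1]
      rw [List.filter_append, List.filter_append, List.filter_cons_of_neg (by simpa using hpS)]

open Matrix.Norms.L2Operator in
theorem integral_wordProd_of_nodup {B : Matrix (Fin m) (Fin m) ℂ} {u : ℝ}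
    (hBA : B * edgeMean G u = 1) (L : List (Λ × Λ)) (hL : (L.map stepKey).Nodup) :
    ∫ ω : PosEdge Λ → G, wordProd B ω L ∂(disorderLaw G Λ u) = 1 := by
  classical
  rw [integral_wordProd_filter hBA ∅ _ L rfl (hL.filter _)]
  simp [wordProd]

open Classical Matrix.Norms.L2Operator in
/-- The correlation of two words is controlled by the number of edges that they share. -/
theorem norm_integral_wordProd_mul_le {B : Matrix (Fin m) (Fin m) ℂ} {u c : ℝ}
    (hBA : B * edgeMean G u = 1) (hBG : ∀ h : G, mat h * B = B * mat h)
    (hBs : B.conjTranspose = B) (hc : 1 ≤ c) (hB : ‖B‖ ≤ c) (L L' : List (Λ × Λ))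
    (hL : (L.map stepKey).Nodup) (hL' : (L'.map stepKey).Nodup) (N : ℕ)
    (hN : (L.filter (stepKey · ∈ L'.map stepKey)).length ≤ N)
    (hN' : (L'.filter (stepKey · ∈ L.map stepKey)).length ≤ N) :
    ‖∫ ω : PosEdge Λ → G, wordProd B ω L * (wordProd B ω L').conjTranspose ∂(disorderLaw G Λ u)‖ ≤
      c ^ (2 * N) := by
  simp only [conjTranspose_wordProd hBG hBs, ← wordProd_append]
  -- Only shared edges survive: at most `N` letters from each word, each of norm at most `c`.
  set S : Set (Sym2 Λ) := {k | k ∈ L.map stepKey ∧ k ∈ L'.map stepKey} with hS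
  have hkeys : ((L'.map Prod.swap).reverse).map stepKey = (L'.map stepKey).reverse := by
    rw [List.map_reverse, List.map_map]
    congr 2
    funext p
    exact stepKey_swap p
  rw [integral_wordProd_filter hBA S _ _ rfl]
  · refine (norm_integral_le_of_norm_le_const (Filter.Eventually.of_forall
      fun ω => norm_wordProd_le hc hB ω _)).trans ?_
    rw [probReal_univ, mul_one]
    refine pow_le_pow_right₀ hc ?_
    rw [List.filter_append, List.length_append, two_mul]
    refine Nat.add_le_add (le_trans (le_of_eq ?_) hN) (le_trans (le_of_eq ?_) hN')
    · congr 1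
      refine List.filter_congr fun p hp => ?_
      have : stepKey p ∈ L.map stepKey := List.mem_map_of_mem hp
      simp only [hS, Set.mem_ofPred_eq, this, true_and]
    · rw [List.filter_reverse, List.length_reverse, List.filter_map, List.length_map]
      congr 1
      refine List.filter_congr fun p hp => ?_
      have : stepKey p ∈ L'.map stepKey := List.mem_map_of_mem hp
      simp only [hS, Set.mem_ofPred_eq, Function.comp, stepKey_swap, this, and_true]
  · rw [List.map_append, hkeys, List.filter_append, List.filter_reverse]
    refine List.Nodup.append (hL.filter _) (List.nodup_reverse.2 (hL'.filter _)) ?_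
    intro k hk hk'
    rw [List.mem_reverse] at hk'
    have h1 := List.mem_filter.1 hk
    have h2 := List.mem_filter.1 hk'
    have h3 : k ∉ S := by simpa using h1.2
    exact h3 ⟨h1.1, h2.1⟩

end Words

/-! ### Path estimators and alignment -/

section Paths

variable {m : ℕ} {G : Subgroup (Matrix.unitaryGroup (Fin m) ℂ)} {d : ℕ} {Λ : Finset (Fin d → ℤ)}

/-- The list of the first `n` steps of a path. -/
def pathWord (q : ℕ → Λ) (n : ℕ) : List (Λ × Λ) := (List.range n).map fun k => (q k, q (k + 1))

/-- The gauge factors telescope along the path; pauses are harmless, as their letter is 1. -/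
theorem wordProd_pathWord_gauge {B : Matrix (Fin m) (Fin m) ℂ}
    (hBG : ∀ h : G, mat h * B = B * mat h) (V : Λ → G) (ω : PosEdge Λ → G) (q : ℕ → Λ) (n : ℕ)
    (hq : ∀ k < n, q k = q (k + 1) ∨ (latticeGraph d).Adj (q k) (q (k + 1))) :
    wordProd B (gauge V ω) (pathWord q n) =
      mat (V (q 0)) * wordProd B ω (pathWord q n) * mat (V (q n))⁻¹ := by
  induction n with
  | zero => simp [pathWord, wordProd]
  | succ n ih =>
    have hsplit : pathWord q (n + 1) = pathWord q n ++ [(q n, q (n + 1))] := by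
      simp [pathWord, List.range_succ]
    have hone : ∀ ω : PosEdge Λ → G, wordProd B ω [(q n, q (n + 1))] =
        letter B ω (q n, q (n + 1)) := fun ω => by simp [wordProd]
    rw [hsplit, wordProd_append, wordProd_append, hone, hone, ih fun k hk => hq k (by omega),
      letter_gauge hBG V ω (hq n (by omega))]
    have := mat_inv_mul_mat (V (q n))
    calc mat (V (q 0)) * wordProd B ω (pathWord q n) * mat (V (q n))⁻¹ *
          (mat (V (q n)) * letter B ω (q n, q (n + 1)) * mat (V (q (n + 1)))⁻¹)
        = mat (V (q 0)) * wordProd B ω (pathWord q n) * (mat (V (q n))⁻¹ * mat (V (q n))) *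
          letter B ω (q n, q (n + 1)) * mat (V (q (n + 1)))⁻¹ := by simp only [mul_assoc]
      _ = _ := by rw [this]; simp only [mul_assoc, mul_one]

variable [CompactSpace G]

open Matrix.Norms.L2Operator in
theorem integral_re_trace {X : Type*} [MeasurableSpace X] (μ : Measure X)
    (F : X → Matrix (Fin m) (Fin m) ℂ) (hF : Integrable F μ) :
    ∫ x, (Matrix.trace (F x)).re ∂μ = (Matrix.trace (∫ x, F x ∂μ)).re :=
  ContinuousLinearMap.integral_comp_comm (Complex.reCLM.comp
    (LinearMap.toContinuousLinearMap (Matrix.traceLinearMap (Fin m) ℝ ℂ))) hF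

open Matrix.Norms.L2Operator in
/-- The error of the estimator obtained by averaging over a family of words. -/
theorem integral_hsSq_average_sub_one_le {B : Matrix (Fin m) (Fin m) ℂ} {u c : ℝ}
    (hBA : B * edgeMean G u = 1) (hBG : ∀ h : G, mat h * B = B * mat h)
    (hBs : B.conjTranspose = B) (hc : 1 ≤ c) (hB : ‖B‖ ≤ c)
    {I : Type*} [Fintype I] [Nonempty I] (L : I → List (Λ × Λ))
    (hL : ∀ D, ((L D).map stepKey).Nodup) (N : I → I → ℕ) (hNs : ∀ D D', N D D' = N D' D)
    (hN : ∀ D D', letI := Classical.decEq (Sym2 Λ);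
      ((L D).filter (stepKey · ∈ (L D').map stepKey)).length ≤ N D D')
    {K : ℝ} (hK : ∀ D', ∑ D, c ^ (2 * N D D') ≤ Fintype.card I * K) :
    ∫ ω : PosEdge Λ → G, hsSq ((Fintype.card I : ℂ)⁻¹ • ∑ D, wordProd B ω (L D) - 1)
      ∂(disorderLaw G Λ u) ≤ m * (K - 1) := by
  set r : ℝ := (Fintype.card I : ℝ)⁻¹ with hr
  have hcard : (0 : ℝ) < Fintype.card I := by exact_mod_cast Fintype.card_pos
  have hr0 : 0 ≤ r := by positivity
  have hrr : r * Fintype.card I = 1 := inv_mul_cancel₀ hcard.ne'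
  have hcast : (Fintype.card I : ℂ)⁻¹ = (r : ℂ) := by rw [hr]; push_cast; rfl
  -- The square is expanded. The linear term has mean exactly `2 * m`, so only the pair correlations
  -- need a bound.
  have hexp : ∀ ω : PosEdge Λ → G,
      hsSq ((Fintype.card I : ℂ)⁻¹ • ∑ D, wordProd B ω (L D) - 1) =
      r ^ 2 * ∑ D', ∑ D,
        (Matrix.trace (wordProd B ω (L D) * (wordProd B ω (L D')).conjTranspose)).re + m -
      2 * (r * ∑ D, (Matrix.trace (wordProd B ω (L D))).re) := by
    intro ω
    have h1 : hsSq (1 : Matrix (Fin m) (Fin m) ℂ) = m := hsSq_mat (1 : G)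
    rw [hsSq_sub, h1, hsSq_eq_trace, hcast]
    congr 1
    · congr 1
      rw [Matrix.conjTranspose_smul, smul_mul_smul_comm, Matrix.trace_smul,
        Matrix.conjTranspose_sum, Finset.sum_mul_sum, Matrix.trace_sum, RCLike.star_def,
        Complex.conj_ofReal, ← Complex.ofReal_mul, smul_eq_mul, Complex.re_ofReal_mul,
        Complex.re_sum, ← pow_two, Finset.sum_comm]
      simp only [Matrix.trace_sum, Complex.re_sum]
    · rw [Matrix.conjTranspose_one, mul_one, Matrix.trace_smul, smul_eq_mul,
        Complex.re_ofReal_mul, Matrix.trace_sum, Complex.re_sum]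
  simp only [hexp]
  have hcw : ∀ D, Continuous fun ω : PosEdge Λ → G => wordProd B ω (L D) :=
    fun D => continuous_wordProd B (L D)
  have hcww : ∀ D D', Continuous fun ω : PosEdge Λ → G =>
      wordProd B ω (L D) * (wordProd B ω (L D')).conjTranspose :=
    fun D D' => (hcw D).mul (hcw D').matrix_conjTranspose
  have hct : ∀ D, Continuous fun ω : PosEdge Λ → G => (Matrix.trace (wordProd B ω (L D))).re :=
    fun D => Complex.continuous_re.comp (hcw D).matrix_trace
  have hctt : ∀ D D', Continuous fun ω : PosEdge Λ → G =>
      (Matrix.trace (wordProd B ω (L D) * (wordProd B ω (L D')).conjTranspose)).re :=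
    fun D D' => Complex.continuous_re.comp (hcww D D').matrix_trace
  have i1 : Integrable (fun ω : PosEdge Λ → G => r ^ 2 * ∑ D', ∑ D,
      (Matrix.trace (wordProd B ω (L D) * (wordProd B ω (L D')).conjTranspose)).re)
      (disorderLaw G Λ u) :=
    Continuous.integrable_of_compactSpace (continuous_const.mul
      (continuous_finsetSum _ fun D' _ => continuous_finsetSum _ fun D _ => hctt D D'))
  have i2 : Integrable (fun ω : PosEdge Λ → G =>
      2 * (r * ∑ D, (Matrix.trace (wordProd B ω (L D))).re)) (disorderLaw G Λ u) :=
    Continuous.integrable_of_compactSpace (continuous_const.mul (continuous_const.mul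
      (continuous_finsetSum _ fun D _ => hct D)))
  have i3 : Integrable (fun ω : PosEdge Λ → G => r ^ 2 * ∑ D', ∑ D,
      (Matrix.trace (wordProd B ω (L D) * (wordProd B ω (L D')).conjTranspose)).re + m)
      (disorderLaw G Λ u) := i1.add (integrable_const _)
  rw [integral_sub i3 i2, integral_add i1 (integrable_const _),
    integral_const, integral_const_mul, integral_const_mul, integral_const_mul,
    integral_finsetSum _ fun D _ => Continuous.integrable_of_compactSpace (hct D),
    integral_finsetSum _ fun D' _ => Continuous.integrable_of_compactSpace
      (continuous_finsetSum _ fun D _ => hctt D D')]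
  have hone : ∀ D, ∫ ω : PosEdge Λ → G, (Matrix.trace (wordProd B ω (L D))).re
      ∂(disorderLaw G Λ u) = m := by
    intro D
    rw [integral_re_trace _ _ (Continuous.integrable_of_compactSpace (hcw D)),
      integral_wordProd_of_nodup hBA _ (hL D)]
    simp
  have htwo : ∀ D', ∫ ω : PosEdge Λ → G, ∑ D,
      (Matrix.trace (wordProd B ω (L D) * (wordProd B ω (L D')).conjTranspose)).re
      ∂(disorderLaw G Λ u) ≤ m * (Fintype.card I * K) := by
    intro D'
    rw [integral_finsetSum _ fun D _ => Continuous.integrable_of_compactSpace (hctt D D')]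
    refine le_trans ?_ (mul_le_mul_of_nonneg_left (hK D') (Nat.cast_nonneg m))
    rw [Finset.mul_sum]
    refine Finset.sum_le_sum fun D _ => ?_
    rw [integral_re_trace _ _ (Continuous.integrable_of_compactSpace (hcww D D'))]
    refine (le_abs_self _).trans ((abs_re_trace_le _).trans ?_)
    refine mul_le_mul_of_nonneg_left ?_ (Nat.cast_nonneg m)
    refine norm_integral_wordProd_mul_le hBA hBG hBs hc hB _ _ (hL D) (hL D') _ ?_ ?_
    · convert hN D D'
    · rw [hNs]; convert hN D' D
  have hsum := Finset.sum_le_sum fun D' (_ : D' ∈ Finset.univ) => htwo D'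
  rw [Finset.sum_const, Finset.card_univ, nsmul_eq_mul] at hsum
  simp only [hone, Finset.sum_const, Finset.card_univ, nsmul_eq_mul, probReal_univ, one_smul]
  have h3 := mul_le_mul_of_nonneg_left hsum (sq_nonneg r)
  have h4 : r ^ 2 * (Fintype.card I * (m * (Fintype.card I * K))) = m * K := by
    calc r ^ 2 * (Fintype.card I * (m * (Fintype.card I * K)))
        = (r * Fintype.card I) ^ 2 * (m * K) := by ring
      _ = m * K := by rw [hrr]; ring
  have h5 : r * (Fintype.card I * (m : ℝ)) = m := by rw [← mul_assoc, hrr, one_mul]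
  rw [h4] at h3
  rw [h5]
  linarith

instance isProbabilityMeasure_gibbs (β : ℝ) (bd : Finset (Fin d → ℤ)) (ω : PosEdge Λ → G) :
    IsProbabilityMeasure (gibbs β bd ω) :=
  isProbabilityMeasure_tilted (Continuous.integrable_of_compactSpace
    (continuous_of_uncurry (continuous_exp_interaction β) ω))

/-- The mean squared misalignment of two spins. -/
def misalignment (β : ℝ) (bd : Finset (Fin d → ℤ)) (x y : Λ) : ℝ :=
  nishimoriExpectation G Λ β bd fun U => hsSq (mat (U x) - mat (U y))

theorem nishimoriExpectation_mono (β : ℝ) (bd : Finset (Fin d → ℤ)) {f g : (Λ → G) → ℝ}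
    (hf : Continuous f) (hg : Continuous g) (h : ∀ U, f U ≤ g U) :
    nishimoriExpectation G Λ β bd f ≤ nishimoriExpectation G Λ β bd g := by
  have hf' : Continuous (Function.uncurry fun (_ : PosEdge Λ → G) U => f U) :=
    hf.comp continuous_snd
  have hg' : Continuous (Function.uncurry fun (_ : PosEdge Λ → G) U => g U) :=
    hg.comp continuous_snd
  refine integral_mono (Continuous.integrable_of_compactSpace
    (continuous_integral_gibbs β bd _ hf')) (Continuous.integrable_of_compactSpace
    (continuous_integral_gibbs β bd _ hg')) fun ω => ?_
  exact integral_mono (Continuous.integrable_of_compactSpace hf)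
    (Continuous.integrable_of_compactSpace hg) h

/-- Two spins are aligned as well as the relative gauge is recovered from the disorder by a
gauge-equivariant estimator `T`. -/
theorem misalignment_le_of_estimator {β : ℝ} (bd : Finset (Fin d → ℤ)) (x y : Λ)
    (T : (PosEdge Λ → G) → Matrix (Fin m) (Fin m) ℂ) (hT : Continuous T)
    (hTg : ∀ (V : Λ → G) ω, T (gauge V ω) = mat (V x) * T ω * mat (V y)⁻¹) :
    misalignment (G := G) β bd x y ≤
      4 * ∫ ω, hsSq (T ω - 1) ∂(disorderLaw G Λ β) := by
  have hcx : ∀ z : Λ, Continuous fun p : (PosEdge Λ → G) × (Λ → G) => mat (p.2 z) :=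
    fun z => continuous_mat.comp ((continuous_apply z).comp continuous_snd)
  -- Equivariance of `T` makes `g` gauge invariant, and at the trivial configuration it is the error
  -- of `T`. That error appears once through `g` and once directly, each time with a factor 2.
  set g : (PosEdge Λ → G) → (Λ → G) → ℝ :=
    fun ω U => hsSq (mat (U x) - T ω * mat (U y)) with hg
  have hgc : Continuous (Function.uncurry g) :=
    continuous_hsSq.comp ((hcx x).sub ((hT.comp continuous_fst).mul (hcx y)))
  have hginv : ∀ V U ω, g (gauge V ω) (V * U) = g ω U := by
    intro V U ω
    simp only [hg, hTg, Pi.mul_apply, mat_mul]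
    rw [← hsSq_mat_mul (V x) (mat (U x) - T ω * mat (U y)), mul_sub]
    congr 2
    calc mat (V x) * T ω * mat (V y)⁻¹ * (mat (V y) * mat (U y))
        = mat (V x) * T ω * (mat (V y)⁻¹ * mat (V y)) * mat (U y) := by simp only [mul_assoc]
      _ = _ := by rw [mat_inv_mul_mat, mul_one, mul_assoc]
  have hnish := nishimori_identity β bd g hgc fun V U ω _ => hginv V U ω
  have hg1 : ∀ ω, g ω 1 = hsSq (T ω - 1) := by
    intro ω
    simp only [hg, Pi.one_apply, mat_one, mul_one]
    exact hsSq_sub_comm _ _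
  simp only [hg1] at hnish
  have hcT : Continuous fun ω => hsSq (T ω - 1) := continuous_hsSq.comp (hT.sub continuous_const)
  have hcg : Continuous fun ω => ∫ U, g ω U ∂(gibbs β bd ω) :=
    continuous_integral_gibbs β bd g hgc
  have hcd : Continuous fun U : Λ → G => hsSq (mat (U x) - mat (U y)) :=
    continuous_hsSq.comp ((continuous_mat.comp (continuous_apply x)).sub
      (continuous_mat.comp (continuous_apply y)))
  have hcd' : Continuous (Function.uncurry fun (_ : PosEdge Λ → G) (U : Λ → G) =>
      hsSq (mat (U x) - mat (U y))) := hcd.comp continuous_snd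
  have hpt : ∀ ω, ∫ U, hsSq (mat (U x) - mat (U y)) ∂(gibbs β bd ω) ≤
      2 * ∫ U, g ω U ∂(gibbs β bd ω) + 2 * hsSq (T ω - 1) := by
    intro ω
    have hgi : Integrable (fun U => g ω U) (gibbs β bd ω) :=
      Continuous.integrable_of_compactSpace (continuous_of_uncurry hgc ω)
    calc ∫ U, hsSq (mat (U x) - mat (U y)) ∂(gibbs β bd ω)
        ≤ ∫ U, (2 * g ω U + 2 * hsSq (T ω - 1)) ∂(gibbs β bd ω) := by
          refine integral_mono (Continuous.integrable_of_compactSpace hcd)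
            ((hgi.const_mul 2).add (integrable_const _)) fun U => ?_
          have e : mat (U x) - mat (U y) =
              (mat (U x) - T ω * mat (U y)) + (T ω - 1) * mat (U y) := by
            rw [sub_mul, one_mul]; abel
          simp only
          rw [e, ← hsSq_mul_mat (U y) (T ω - 1)]
          exact hsSq_add_le _ _
      _ = _ := by
          rw [integral_add (hgi.const_mul 2) (integrable_const _), integral_const_mul,
            integral_const]
          simp
  have hcg2 : Integrable (fun ω => 2 * ∫ U, g ω U ∂(gibbs β bd ω)) (disorderLaw G Λ β) :=
    Continuous.integrable_of_compactSpace (continuous_const.mul hcg)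
  have hcT2 : Integrable (fun ω => 2 * hsSq (T ω - 1)) (disorderLaw G Λ β) :=
    Continuous.integrable_of_compactSpace (continuous_const.mul hcT)
  calc misalignment (G := G) β bd x y
      ≤ ∫ ω, (2 * ∫ U, g ω U ∂(gibbs β bd ω) + 2 * hsSq (T ω - 1)) ∂(disorderLaw G Λ β) :=
        integral_mono (Continuous.integrable_of_compactSpace
          (continuous_integral_gibbs β bd _ hcd')) (hcg2.add hcT2) hpt
    _ = 2 * ∫ ω, ∫ U, g ω U ∂(gibbs β bd ω) ∂(disorderLaw G Λ β) +
        2 * ∫ ω, hsSq (T ω - 1) ∂(disorderLaw G Λ β) := by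
        rw [integral_add hcg2 hcT2, integral_const_mul, integral_const_mul]
    _ = _ := by rw [hnish]; ring

open Matrix.Norms.L2Operator in
theorem misalignment_le_of_paths {B : Matrix (Fin m) (Fin m) ℂ} {β c : ℝ}
    (hBA : B * edgeMean G β = 1) (hBG : ∀ h : G, mat h * B = B * mat h)
    (hBs : B.conjTranspose = B) (hc : 1 ≤ c) (hB : ‖B‖ ≤ c)
    (bd : Finset (Fin d → ℤ)) (x y : Λ)
    {I : Type*} [Fintype I] [Nonempty I] (q : I → ℕ → Λ) (n : ℕ)
    (hq0 : ∀ D, q D 0 = x) (hqn : ∀ D, q D n = y)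
    (hq : ∀ D, ∀ k < n, q D k = q D (k + 1) ∨ (latticeGraph d).Adj (q D k) (q D (k + 1)))
    (hL : ∀ D, ((pathWord (q D) n).map stepKey).Nodup)
    (N : I → I → ℕ) (hNs : ∀ D D', N D D' = N D' D)
    (hN : ∀ D D', letI := Classical.decEq (Sym2 Λ);
      ((pathWord (q D) n).filter (stepKey · ∈ (pathWord (q D') n).map stepKey)).length ≤ N D D')
    {K : ℝ} (hK : ∀ D', ∑ D, c ^ (2 * N D D') ≤ Fintype.card I * K) :
    misalignment (G := G) β bd x y ≤ 4 * (m * (K - 1)) := by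
  refine (misalignment_le_of_estimator bd x y
    (fun ω => (Fintype.card I : ℂ)⁻¹ • ∑ D, wordProd B ω (pathWord (q D) n)) ?_ ?_).trans
    (mul_le_mul_of_nonneg_left
      (integral_hsSq_average_sub_one_le hBA hBG hBs hc hB _ hL N hNs hN hK) (by norm_num))
  · have hsum : Continuous fun ω : PosEdge Λ → G => ∑ D, wordProd B ω (pathWord (q D) n) :=
      continuous_finsetSum _ fun D _ => continuous_wordProd B _
    exact hsum.const_smul ((Fintype.card I : ℂ)⁻¹)
  · intro V ω
    have h : ∀ D, wordProd B (gauge V ω) (pathWord (q D) n) =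
        mat (V x) * wordProd B ω (pathWord (q D) n) * mat (V y)⁻¹ := by
      intro D
      rw [wordProd_pathWord_gauge hBG V ω (q D) n (hq D), hq0, hqn]
    simp only [h]
    rw [← Finset.sum_mul, ← Finset.mul_sum, mul_smul_comm, smul_mul_assoc]

end Paths

/-! ### Lattice paths along an axis -/

section AxisPaths

variable {d : ℕ}

theorem adj_of_eq_of_ne {x y : Fin d → ℤ} (i : Fin d) (h : ∀ j ≠ i, x j = y j)
    (hi : |x i - y i| = 1) : (latticeGraph d).Adj x y := by
  change ∑ k, |x k - y k| = 1
  rw [Finset.sum_eq_single i (fun j _ hj => by rw [h j hj]; simp) (by simp), hi]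

/-- The point at height `h` above `w` in direction `k`, displaced by `p` in directions `a, b`. -/
def displacedPoint (w : Fin d → ℤ) (k a b : Fin d) (h : ℕ) (p : ℕ × ℕ) : Fin d → ℤ :=
  fun i => w i + (if i = k then (h : ℤ) else 0) + (if i = a then (p.1 : ℤ) else 0) +
    (if i = b then (p.2 : ℤ) else 0)

/-- The time parameter of the transverse displacement after `j` steps: up and down again. -/
def transverseTime (L j : ℕ) : ℕ := min j (2 * L - 1 - j) / 2

theorem displacedPoint_injective {w : Fin d → ℤ} {k a b : Fin d} (hka : k ≠ a) (hkb : k ≠ b)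
    (hab : a ≠ b) {h h' : ℕ} {p p' : ℕ × ℕ}
    (heq : displacedPoint w k a b h p = displacedPoint w k a b h' p') : h = h' ∧ p = p' := by
  have h1 := congrFun heq k
  have h2 := congrFun heq a
  have h3 := congrFun heq b
  simp only [displacedPoint, if_true, hka, hkb, hka.symm, hkb.symm, hab, hab.symm,
    if_false] at h1 h2 h3
  exact ⟨by omega, Prod.ext (by omega) (by omega)⟩

variable (w : Fin d → ℤ) (k a b : Fin d) (L : ℕ) (f : ℕ → ℕ × ℕ)

/-- A path from `w` to `w + L e_k` with transverse displacement `f`, longitudinal and transverse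
steps alternating. -/
def axisPath (j : ℕ) : Fin d → ℤ :=
  displacedPoint w k a b ((j + 1) / 2) (f (transverseTime L j))

variable {w k a b L f}

theorem axisPath_zero (hf0 : f 0 = 0) : axisPath w k a b L f 0 = w := by
  funext i
  simp [axisPath, displacedPoint, transverseTime, hf0]

theorem axisPath_last (hf0 : f 0 = 0) (hL : 1 ≤ L) :
    axisPath w k a b L f (2 * L - 1) = displacedPoint w k a b L 0 := by
  unfold axisPath transverseTime
  rw [Nat.sub_self, Nat.min_zero, Nat.zero_div, hf0]
  congr 1
  omega

theorem adj_displacedPoint_longitudinal (hka : k ≠ a) (hkb : k ≠ b) (h : ℕ) (p : ℕ × ℕ) :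
    (latticeGraph d).Adj (displacedPoint w k a b h p) (displacedPoint w k a b (h + 1) p) := by
  refine adj_of_eq_of_ne k (fun j hj => ?_) ?_
  · simp [displacedPoint, hj]
  · simp only [displacedPoint, if_true, hka, hkb, if_false]
    push_cast
    ring_nf
    norm_num

theorem adj_displacedPoint_fst (hka : k ≠ a) (hab : a ≠ b) (h : ℕ) (p : ℕ × ℕ) :
    (latticeGraph d).Adj (displacedPoint w k a b h p)
      (displacedPoint w k a b h (p + (1, 0))) := by
  refine adj_of_eq_of_ne a (fun j hj => ?_) ?_
  · simp [displacedPoint, hj]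
  · simp only [displacedPoint, if_true, hka.symm, hab, if_false, Prod.fst_add]
    push_cast
    ring_nf
    norm_num

theorem adj_displacedPoint_snd (hkb : k ≠ b) (hab : a ≠ b) (h : ℕ) (p : ℕ × ℕ) :
    (latticeGraph d).Adj (displacedPoint w k a b h p)
      (displacedPoint w k a b h (p + (0, 1))) := by
  refine adj_of_eq_of_ne b (fun j hj => ?_) ?_
  · simp [displacedPoint, hj]
  · simp only [displacedPoint, if_true, hkb.symm, hab.symm, if_false, Prod.snd_add]
    push_cast
    ring_nf
    norm_num

theorem transverse_step (hka : k ≠ a) (hkb : k ≠ b) (hab : a ≠ b)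
    (hf : ∀ u, f (u + 1) = f u ∨ f (u + 1) = f u + (1, 0) ∨ f (u + 1) = f u + (0, 1))
    (h u : ℕ) : displacedPoint w k a b h (f u) = displacedPoint w k a b h (f (u + 1)) ∨
      (latticeGraph d).Adj (displacedPoint w k a b h (f u))
        (displacedPoint w k a b h (f (u + 1))) := by
  rcases hf u with h1 | h1 | h1 <;> rw [h1]
  · exact Or.inl rfl
  · exact Or.inr (adj_displacedPoint_fst hka hab _ _)
  · exact Or.inr (adj_displacedPoint_snd hkb hab _ _)

theorem axisPath_step (hka : k ≠ a) (hkb : k ≠ b) (hab : a ≠ b)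
    (hf : ∀ u, f (u + 1) = f u ∨ f (u + 1) = f u + (1, 0) ∨ f (u + 1) = f u + (0, 1))
    (j : ℕ) :
    axisPath w k a b L f j = axisPath w k a b L f (j + 1) ∨
      (latticeGraph d).Adj (axisPath w k a b L f j) (axisPath w k a b L f (j + 1)) := by
  unfold axisPath
  rcases Nat.even_or_odd' j with ⟨l, hl | hl⟩
  · have h1 : transverseTime L (j + 1) = transverseTime L j := by
      unfold transverseTime; omega
    have h2 : (j + 1 + 1) / 2 = (j + 1) / 2 + 1 := by omega
    rw [h1, h2]
    exact Or.inr (adj_displacedPoint_longitudinal hka hkb _ _)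
  · have h2 : (j + 1 + 1) / 2 = (j + 1) / 2 := by omega
    rw [h2]
    have h3 : transverseTime L (j + 1) = transverseTime L j ∨
        transverseTime L (j + 1) = transverseTime L j + 1 ∨
        transverseTime L j = transverseTime L (j + 1) + 1 := by
      unfold transverseTime; omega
    rcases h3 with h3 | h3 | h3
    · exact Or.inl (by rw [h3])
    · rw [h3]; exact transverse_step hka hkb hab hf _ _
    · rw [h3]
      exact (transverse_step hka hkb hab hf _ _).imp Eq.symm SimpleGraph.Adj.symm

theorem monotone_of_steps
    (hf : ∀ u, f (u + 1) = f u ∨ f (u + 1) = f u + (1, 0) ∨ f (u + 1) = f u + (0, 1)) :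
    Monotone f := by
  refine monotone_nat_of_le_succ fun u => ?_
  rcases hf u with h | h | h <;> rw [h]
  · exact le_self_add
  · exact le_self_add

/-- Two axis paths use the same edge only at the same time and at the same displacement. -/
theorem eq_of_axisPath_edge_eq {f' : ℕ → ℕ × ℕ} (hka : k ≠ a) (hkb : k ≠ b) (hab : a ≠ b)
    (hf : Monotone f) (hf' : Monotone f') {j j' : ℕ}
    (h : s(axisPath w k a b L f j, axisPath w k a b L f (j + 1)) =
      s(axisPath w k a b L f' j', axisPath w k a b L f' (j' + 1))) :
    j = j' ∧ f (transverseTime L j) = f' (transverseTime L j) := by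
  rcases Sym2.eq_iff.1 h with ⟨h1, h2⟩ | ⟨h1, h2⟩
  · obtain ⟨e1, e2⟩ := displacedPoint_injective hka hkb hab h1
    obtain ⟨e3, -⟩ := displacedPoint_injective hka hkb hab h2
    obtain rfl : j = j' := by omega
    exact ⟨rfl, e2⟩
  -- Opposite traversals: monotonicity of both displacements leaves only equality.
  · obtain ⟨e1, e2⟩ := displacedPoint_injective hka hkb hab h1
    obtain ⟨e3, e4⟩ := displacedPoint_injective hka hkb hab h2
    obtain rfl : j = j' := by omega
    refine ⟨rfl, ?_⟩
    rcases le_total (transverseTime L j) (transverseTime L (j + 1)) with hle | hle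
    · refine le_antisymm ((hf hle).trans e4.le) ?_
      rw [e2]; exact hf' hle
    · refine le_antisymm (e2.le.trans (hf' hle)) ?_
      rw [← e4]; exact hf hle

/-- Each transverse time is visited by at most two steps on the way out and two on the way back.
Hence one coincidence of displacements costs at most four shared edges. -/
theorem card_transverseTime_fiber_le (L u : ℕ) (s : Finset ℕ)
    (hs : ∀ j ∈ s, j < 2 * L - 1) : (s.filter (transverseTime L · = u)).card ≤ 4 := by
  refine (Finset.card_le_card (t := {2 * u, 2 * u + 1, 2 * L - 1 - 2 * u, 2 * L - 2 - 2 * u})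
    fun j hj => ?_).trans Finset.card_le_four
  have h1 := Finset.mem_filter.1 hj
  have h2 := hs j h1.1
  have h3 := h1.2
  unfold transverseTime at h3
  simp only [Finset.mem_insert, Finset.mem_singleton]
  omega

theorem two_mul_transverseTime_le (L j : ℕ) : 2 * transverseTime L j ≤ L := by
  unfold transverseTime; omega

theorem transverseTime_lt {L j : ℕ} (hj : j < 2 * L - 1) : transverseTime L j < L := by
  unfold transverseTime; omega

theorem fst_add_snd_le
    (hf0 : f 0 = 0)
    (hf : ∀ u, f (u + 1) = f u ∨ f (u + 1) = f u + (1, 0) ∨ f (u + 1) = f u + (0, 1)) (u : ℕ) :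
    (f u).1 + (f u).2 ≤ u := by
  induction u with
  | zero => simp [hf0]
  | succ u ih =>
    rcases hf u with h | h | h <;> rw [h]
    · omega
    · simp only [Prod.fst_add, Prod.snd_add]; omega
    · simp only [Prod.fst_add, Prod.snd_add]; omega

end AxisPaths

/-! ### Alignment along one axis-parallel segment -/

section AxisHop

open Matrix.Norms.L2Operator in
/-- Alignment of two spins at the ends of an axis-parallel segment of a domain that contains the
relevant points around the segment. -/
theorem exists_misalignment_le_of_axis (d : ℕ) (hd : 3 ≤ d) :
    ∃ M : ℝ, 0 < M ∧ ∀ (m : ℕ) (G : Subgroup (Matrix.unitaryGroup (Fin m) ℂ)) [CompactSpace G]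
      (B : Matrix (Fin m) (Fin m) ℂ) (β c : ℝ), B * edgeMean G β = 1 →
      (∀ h : G, mat h * B = B * mat h) → B.conjTranspose = B → 1 ≤ c → ‖B‖ ≤ c →
      (c ^ 8 - 1) * M ≤ 1 / 2 →
      ∀ (Λ bd : Finset (Fin d → ℤ)) (w : Fin d → ℤ) (k : Fin d) (L : ℕ), 1 ≤ L →
      (∀ a b : Fin d, k ≠ a → k ≠ b → a ≠ b → ∀ (h : ℕ) (p : ℕ × ℕ), h ≤ L → 2 * p.1 ≤ L →
        2 * p.2 ≤ L → displacedPoint w k a b h p ∈ Λ) →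
      ∀ x y : Λ, (x : Fin d → ℤ) = w →
        (y : Fin d → ℤ) = (fun i => w i + if i = k then (L : ℤ) else 0) →
        misalignment (G := G) β bd x y ≤ 8 * m * ((c ^ 8 - 1) * M) := by
  classical
  obtain ⟨M, hM0, hM⟩ := exists_unpredictable_paths
  refine ⟨M, hM0, fun m G _ B β c hBA hBG hBs hc hB hsM Λ bd w k L hL hΛ x y hx hy => ?_⟩
  -- Two transverse directions `a` and `b`: this is where `3 ≤ d` is used.
  obtain ⟨a, ha⟩ : ∃ a, a ∉ ({k} : Finset (Fin d)) := by
    by_contra hcon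
    push Not at hcon
    have := Finset.card_le_card (fun i _ => hcon i : (Finset.univ : Finset (Fin d)) ⊆ {k})
    simp at this
    omega
  obtain ⟨b, hb⟩ : ∃ b, b ∉ ({k, a} : Finset (Fin d)) := by
    by_contra hcon
    push Not at hcon
    have := (Finset.card_le_card (fun i _ => hcon i :
      (Finset.univ : Finset (Fin d)) ⊆ {k, a})).trans Finset.card_le_two
    simp at this
    omega
  simp only [Finset.mem_singleton, Finset.mem_insert, not_or] at ha hb
  have hka : k ≠ a := fun h => ha h.symm
  have hkb : k ≠ b := fun h => hb.1 h.symm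
  have hab : a ≠ b := fun h => hb.2 h.symm
  obtain ⟨I, _, _, f, hf0, hf, hcoin⟩ := hM L
  have hmem : ∀ D, ∀ j ≤ 2 * L - 1, axisPath w k a b L (f D) j ∈ Λ := by
    intro D j hj
    have h1 := fst_add_snd_le (hf0 D) (hf D) (transverseTime L j)
    have h2 := two_mul_transverseTime_le L j
    exact hΛ a b hka hkb hab _ _ (by omega) (by omega) (by omega)
  -- The default `x` is never taken for `j ≤ 2 * L - 1`.
  set q : I → ℕ → Λ := fun D j =>
    if h : axisPath w k a b L (f D) j ∈ Λ then ⟨_, h⟩ else x with hq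
  have hqval : ∀ D, ∀ j ≤ 2 * L - 1, (q D j : Fin d → ℤ) = axisPath w k a b L (f D) j := by
    intro D j hj
    simp only [hq]
    rw [dif_pos (hmem D j hj)]
  have hkey : ∀ D D', ∀ j < 2 * L - 1, ∀ j' < 2 * L - 1,
      stepKey (q D j, q D (j + 1)) = stepKey (q D' j', q D' (j' + 1)) →
      j = j' ∧ f D (transverseTime L j) = f D' (transverseTime L j) := by
    intro D D' j hj j' hj' h
    have h' := congrArg (Sym2.map Subtype.val) h
    simp only [stepKey, Sym2.map_mk] at h'
    rw [hqval D j hj.le, hqval D (j + 1) hj, hqval D' j' hj'.le, hqval D' (j' + 1) hj'] at h'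
    exact eq_of_axisPath_edge_eq hka hkb hab (monotone_of_steps (hf D))
      (monotone_of_steps (hf D')) h'
  have hfin := misalignment_le_of_paths hBA hBG hBs hc hB bd x y q (2 * L - 1)
    (fun D => Subtype.ext (by rw [hqval D 0 (Nat.zero_le _), axisPath_zero (hf0 D), hx]))
    (fun D => Subtype.ext (by
      rw [hqval D _ le_rfl, axisPath_last (hf0 D) hL, hy]
      funext i
      simp [displacedPoint]))
    (fun D j hj => by
      rcases axisPath_step (w := w) hka hkb hab (hf D) j with h | h
      · exact Or.inl (Subtype.ext (by rw [hqval D j hj.le, hqval D (j + 1) hj, h]))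
      · refine Or.inr ?_
        rw [hqval D j hj.le, hqval D (j + 1) hj]
        exact h)
    (fun D => by
      unfold pathWord
      rw [List.map_map]
      refine List.Nodup.map_on (fun j hj j' hj' h => ?_) List.nodup_range
      exact (hkey D D j (List.mem_range.1 hj) j' (List.mem_range.1 hj') h).1)
    (fun D D' => 4 * (Finset.filter (fun u => f D u = f D' u) (Finset.range L)).card)
    (fun D D' => by simp only [eq_comm])
    (fun D D' => by
      have hle : ((pathWord (q D) (2 * L - 1)).filter
          (stepKey · ∈ (pathWord (q D') (2 * L - 1)).map stepKey)).length ≤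
          (Finset.filter (fun j => f D (transverseTime L j) = f D' (transverseTime L j))
            (Finset.range (2 * L - 1))).card := by
        have e : (Finset.filter (fun j => f D (transverseTime L j) = f D' (transverseTime L j))
            (Finset.range (2 * L - 1))).card = ((List.range (2 * L - 1)).filter
            (fun j => f D (transverseTime L j) = f D' (transverseTime L j))).length := rfl
        have e' : pathWord (q D) (2 * L - 1) =
          (List.range (2 * L - 1)).map fun k => (q D k, q D (k + 1)) := rfl
        rw [e, e', List.filter_map, List.length_map, ← List.countP_eq_length_filter,
          ← List.countP_eq_length_filter]
        refine List.countP_mono_left fun j hj hmem => ?_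
        simp only [Function.comp, decide_eq_true_eq, pathWord, List.map_map,
          List.mem_map, List.mem_range] at hmem ⊢
        obtain ⟨j', hj', hjj⟩ := hmem
        exact (hkey D D' j (List.mem_range.1 hj) j' hj' hjj.symm).2
      have hlt : ∀ j ∈ Finset.filter
          (fun j => f D (transverseTime L j) = f D' (transverseTime L j))
          (Finset.range (2 * L - 1)), j < 2 * L - 1 := fun j hj =>
        Finset.mem_range.1 (Finset.mem_filter.1 hj).1
      have hcard := hle.trans ((Finset.card_le_mul_card_image (f := transverseTime L) _ 4
        fun u _ => card_transverseTime_fiber_le L u _ hlt).trans (Nat.mul_le_mul_left 4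
          (Finset.card_le_card (t := Finset.filter (fun u => f D u = f D' u) (Finset.range L))
            fun u hu => by
              obtain ⟨j, hj, rfl⟩ := Finset.mem_image.1 hu
              exact Finset.mem_filter.2 ⟨Finset.mem_range.2 (transverseTime_lt (hlt j hj)),
                (Finset.mem_filter.1 hj).2⟩)))
      refine le_trans (le_of_eq ?_) hcard
      congr!)
    (K := 1 + 2 * ((c ^ 8 - 1) * M))
    (fun D' => by
      -- The exponent 8 is 2, for the two words, times 4 edges per coincidence.
      have h := hcoin (f D') (c ^ 8 - 1) (by linarith [one_le_pow₀ hc (n := 8)]) hsM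
      refine le_trans (le_of_eq (Finset.sum_congr rfl fun D _ => ?_)) h
      rw [add_sub_cancel, ← pow_mul]
      congr 1
      rw [← mul_assoc]
      congr!)
  refine hfin.trans (le_of_eq (by ring))

end AxisHop

/-! ### Calculus of averaged expectations -/

section Expectation

variable {m : ℕ} {G : Subgroup (Matrix.unitaryGroup (Fin m) ℂ)} {d : ℕ}
  {Λ : Finset (Fin d → ℤ)}

theorem continuous_hsSq_mat_sub (x y : Λ) :
    Continuous fun U : Λ → G => hsSq (mat (U x) - mat (U y)) :=
  continuous_hsSq.comp ((continuous_mat.comp (continuous_apply x)).sub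
    (continuous_mat.comp (continuous_apply y)))

variable [CompactSpace G]

theorem integrable_integral_gibbs (β : ℝ) (bd : Finset (Fin d → ℤ)) {f : (Λ → G) → ℝ}
    (hf : Continuous f) :
    Integrable (fun ω => ∫ U, f U ∂(gibbs β bd ω)) (disorderLaw G Λ β) :=
  Continuous.integrable_of_compactSpace
    (continuous_integral_gibbs β bd (fun _ => f) (hf.comp continuous_snd))

theorem nishimoriExpectation_const (β : ℝ) (bd : Finset (Fin d → ℤ)) (C : ℝ) :
    nishimoriExpectation G Λ β bd (fun _ => C) = C := by
  simp [nishimoriExpectation]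

theorem nishimoriExpectation_add (β : ℝ) (bd : Finset (Fin d → ℤ)) {f g : (Λ → G) → ℝ}
    (hf : Continuous f) (hg : Continuous g) :
    nishimoriExpectation G Λ β bd (fun U => f U + g U) =
      nishimoriExpectation G Λ β bd f + nishimoriExpectation G Λ β bd g := by
  unfold nishimoriExpectation
  rw [← integral_add (integrable_integral_gibbs β bd hf) (integrable_integral_gibbs β bd hg)]
  refine integral_congr_ae (Filter.Eventually.of_forall fun ω => ?_)
  exact integral_add (Continuous.integrable_of_compactSpace hf)
    (Continuous.integrable_of_compactSpace hg)

theorem nishimoriExpectation_const_mul (β : ℝ) (bd : Finset (Fin d → ℤ)) (C : ℝ)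
    (f : (Λ → G) → ℝ) : nishimoriExpectation G Λ β bd (fun U => C * f U) =
      C * nishimoriExpectation G Λ β bd f := by
  unfold nishimoriExpectation
  simp only [integral_const_mul]

theorem nishimoriExpectation_reTr (β : ℝ) (bd : Finset (Fin d → ℤ)) (x y : Λ) :
    nishimoriExpectation G Λ β bd (fun U => reTr ((U x)⁻¹ * U y)) =
      m - 1 / 2 * misalignment (G := G) β bd x y := by
  have h : (fun U : Λ → G => reTr ((U x)⁻¹ * U y)) =
      fun U => (m : ℝ) + (-(1 / 2)) * hsSq (mat (U x) - mat (U y)) := by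
    funext U
    rw [hsSq_mat_sub_mat]; ring
  have hc : Continuous fun U : Λ → G => -(1 / 2) * hsSq (mat (U x) - mat (U y)) :=
    continuous_const.mul (continuous_hsSq_mat_sub x y)
  rw [h, nishimoriExpectation_add β bd continuous_const hc, nishimoriExpectation_const,
    nishimoriExpectation_const_mul]
  unfold misalignment
  ring

theorem misalignment_self (β : ℝ) (bd : Finset (Fin d → ℤ)) (x : Λ) :
    misalignment (G := G) β bd x x = 0 := by
  have h : (fun U : Λ → G => hsSq (mat (U x) - mat (U x))) = fun _ => 0 := by
    funext U; simp [hsSq]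
  unfold misalignment
  rw [h, nishimoriExpectation_const]

theorem misalignment_comm (β : ℝ) (bd : Finset (Fin d → ℤ)) (x y : Λ) :
    misalignment (G := G) β bd x y = misalignment (G := G) β bd y x := by
  unfold misalignment
  congr 1
  funext U
  exact hsSq_sub_comm _ _

theorem misalignment_le_add (β : ℝ) (bd : Finset (Fin d → ℤ)) (x y z : Λ) :
    misalignment (G := G) β bd x z ≤
      2 * misalignment (G := G) β bd x y + 2 * misalignment (G := G) β bd y z := by
  have hc : ∀ v w : Λ, Continuous fun U : Λ → G => 2 * hsSq (mat (U v) - mat (U w)) :=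
    fun v w => continuous_const.mul (continuous_hsSq_mat_sub v w)
  unfold misalignment
  rw [← nishimoriExpectation_const_mul, ← nishimoriExpectation_const_mul,
    ← nishimoriExpectation_add β bd (hc x y) (hc y z)]
  refine nishimoriExpectation_mono β bd (continuous_hsSq_mat_sub x z)
    ((hc x y).add (hc y z)) fun U => ?_
  rw [← sub_add_sub_cancel (mat (U x)) (mat (U y)) (mat (U z))]
  exact hsSq_add_le _ _

/-- Against a spin of the boundary, the alignment is the magnetization. -/
theorem nishimoriExpectation_reTr_of_mem (β : ℝ) (bd : Finset (Fin d → ℤ)) (x y : Λ)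
    (hy : (y : Fin d → ℤ) ∈ bd) :
    nishimoriExpectation G Λ β bd (fun U => reTr (U x)) =
      m - 1 / 2 * misalignment (G := G) β bd x y := by
  rw [← nishimoriExpectation_reTr]
  unfold nishimoriExpectation
  refine integral_congr_ae (Filter.Eventually.of_forall fun ω => ?_)
  refine integral_congr_ae ?_
  have hac : gibbs β bd ω ≪ spinMeasure G Λ bd := tilted_absolutelyContinuous _ _
  filter_upwards [hac.ae_le (ae_spinMeasure_eq_one bd)] with U hU
  rw [hU y hy, mul_one, reTr_inv]

theorem nishimoriExpectation_reTr_le (β : ℝ) (bd : Finset (Fin d → ℤ)) (x : Λ) :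
    nishimoriExpectation G Λ β bd (fun U => reTr (U x)) ≤ m := by
  rw [← nishimoriExpectation_const (G := G) (Λ := Λ) β bd (m : ℝ)]
  exact nishimoriExpectation_mono β bd (continuous_reTr.comp (continuous_apply x))
    continuous_const fun U => reTr_le _

end Expectation

/-! ### Choice of the constants -/

section Constants

theorem inv_pow_eight_sub_one_le {η : ℝ} (h0 : 0 ≤ η) (h1 : η ≤ 1 / 16) :
    (1 - η)⁻¹ ^ 8 - 1 ≤ 16 * η := by
  have h2 : 1 - 8 * η ≤ (1 - η) ^ 8 := by
    have := one_add_mul_le_pow (a := -η) (by linarith) 8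
    norm_num at this
    rw [← sub_eq_add_neg] at this
    linarith
  rw [inv_pow, sub_le_iff_le_add]
  refine (inv_anti₀ (by linarith) h2).trans ?_
  rw [inv_le_iff_one_le_mul₀ (by linarith)]
  nlinarith

open Matrix.Norms.L2Operator in
/-- Uniform alignment along axis-parallel segments at low temperature. -/
theorem exists_uniform_axis_alignment (d : ℕ) (hd : 3 ≤ d) (m : ℕ)
    (G : Subgroup (Matrix.unitaryGroup (Fin m) ℂ)) [CompactSpace G] :
    ∃ βstar a : ℝ, 0 < βstar ∧ 0 < a ∧ ∀ β : ℝ, βstar ≤ β → ∃ t : ℝ, 0 ≤ t ∧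
      2 ^ (d + 3) * t ≤ √(a * Real.log β / β) ∧
      ∀ (Λ bd : Finset (Fin d → ℤ)) (w : Fin d → ℤ) (k : Fin d) (L : ℕ), 1 ≤ L →
      (∀ a b : Fin d, k ≠ a → k ≠ b → a ≠ b → ∀ (h : ℕ) (p : ℕ × ℕ), h ≤ L → 2 * p.1 ≤ L →
        2 * p.2 ≤ L → displacedPoint w k a b h p ∈ Λ) →
      ∀ x y : Λ, (x : Fin d → ℤ) = w →
        (y : Fin d → ℤ) = (fun i => w i + if i = k then (L : ℤ) else 0) →
        misalignment (G := G) β bd x y ≤ 8 * m * t := by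
  obtain ⟨M, hM0, hM⟩ := exists_misalignment_le_of_axis d hd
  obtain ⟨C, hC0, hC⟩ := exists_integral_edgeLaw_le G
  have hlim : Filter.Tendsto (fun β : ℝ => √(2 * (C * (Real.log β / β)))) Filter.atTop
      (nhds 0) := by
    have h := Real.isLittleO_log_id_atTop.tendsto_div_nhds_zero
    have h2 := ((h.const_mul C).const_mul 2).sqrt
    simpa using h2
  -- The first threshold is for `inv_pow_eight_sub_one_le`; the second gives `16 * η * M ≤ 1 / 2`.
  have hev : ∀ᶠ β : ℝ in Filter.atTop, √(2 * (C * (Real.log β / β))) < min (1 / 16) (1 / (32 * M)) :=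
    hlim.eventually_lt_const (by positivity)
  obtain ⟨β₀, hβ₀⟩ := Filter.eventually_atTop.1 hev
  -- With this `a` the square root equals `2 ^ (d + 7) * M * η`, which is `2 ^ (d + 3)` times the
  -- bound `16 * η * M` on `t`.
  refine ⟨max β₀ 3, (2 ^ (d + 7) * M) ^ 2 * (2 * C), by positivity, by positivity,
    fun β hβ => ?_⟩
  have hβ3 : 3 ≤ β := (le_max_right _ _).trans hβ
  set η := √(2 * (C * (Real.log β / β))) with hη
  have hη0 : 0 ≤ η := Real.sqrt_nonneg _
  have hηlt := hβ₀ β ((le_max_left _ _).trans hβ)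
  rw [← hη] at hηlt
  have hη1 : η ≤ 1 / 16 := hηlt.le.trans (min_le_left _ _)
  have hη2 : η * (32 * M) ≤ 1 := by
    have := hηlt.le.trans (min_le_right _ _)
    rwa [le_div_iff₀ (by positivity)] at this
  have hnorm : ‖1 - edgeMean G β‖ ≤ η := by
    refine Real.le_sqrt_of_sq_le ((norm_one_sub_edgeMean_sq_le G β).trans ?_)
    exact mul_le_mul_of_nonneg_left (hC β hβ3) (by norm_num)
  obtain ⟨B, hBA, -, hBG, hBs, hB⟩ := exists_edgeMean_inverse G β η hnorm (by linarith)
  have hc : 1 ≤ (1 - η)⁻¹ := one_le_inv_iff₀.2 ⟨by linarith, by linarith⟩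
  have hs := inv_pow_eight_sub_one_le hη0 hη1
  have hs0 : 0 ≤ (1 - η)⁻¹ ^ 8 - 1 := sub_nonneg.2 (one_le_pow₀ hc)
  have hsM : ((1 - η)⁻¹ ^ 8 - 1) * M ≤ 16 * η * M := mul_le_mul_of_nonneg_right hs hM0.le
  refine ⟨((1 - η)⁻¹ ^ 8 - 1) * M, mul_nonneg hs0 hM0.le, ?_,
    hM m G B β _ hBA hBG hBs hc hB (by linarith)⟩
  have e : (2 ^ (d + 7) * M) ^ 2 * (2 * C) * Real.log β / β =
      (2 ^ (d + 7) * M) ^ 2 * (2 * (C * (Real.log β / β))) := by ring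
  rw [e, Real.sqrt_mul (sq_nonneg _), Real.sqrt_sq (by positivity), ← hη]
  calc 2 ^ (d + 3) * (((1 - η)⁻¹ ^ 8 - 1) * M) ≤ 2 ^ (d + 3) * (16 * η * M) :=
        mul_le_mul_of_nonneg_left hsM (by positivity)
    _ = _ := by ring

end Constants

/-! ### Geometry of the ball -/

section Corners

variable {d : ℕ}

/-- The point that agrees with `y` in the first `j` coordinates and with `x` in the others. -/
def corner (x y : Fin d → ℤ) (j : ℕ) : Fin d → ℤ := fun i => if (i : ℕ) < j then y i else x i

theorem corner_zero (x y : Fin d → ℤ) : corner x y 0 = x := by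
  funext i; simp [corner]

theorem corner_last (x y : Fin d → ℤ) : corner x y d = y := by
  funext i; simp [corner]

theorem corner_succ (x y : Fin d → ℤ) {j : ℕ} (hj : j < d) (i : Fin d) :
    corner x y (j + 1) i = corner x y j i + if i = ⟨j, hj⟩ then y i - x i else 0 := by
  simp only [corner, Fin.ext_iff]
  split_ifs <;> omega

theorem toEuclid_apply (x : Fin d → ℤ) (i : Fin d) : toEuclid x i = (x i : ℝ) := rfl

theorem abs_sub_le_dist_toEuclid (x y : Fin d → ℤ) (i : Fin d) :
    |(y i : ℝ) - x i| ≤ dist (toEuclid x) (toEuclid y) := by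
  rw [dist_comm, dist_eq_norm]
  have := PiLp.norm_apply_le (toEuclid y - toEuclid x) i
  rwa [PiLp.sub_apply, toEuclid_apply, toEuclid_apply, Real.norm_eq_abs] at this

/-- The hypothesis places `v` in the coordinate box with opposite corners `x` and `y`; the bound
holds coordinate by coordinate. -/
theorem dist_midpoint_le {x y v : Fin d → ℤ}
    (hv : ∀ i, |2 * v i - x i - y i| ≤ |y i - x i|) :
    dist (toEuclid v) (midpoint ℝ (toEuclid x) (toEuclid y)) ≤
      dist (toEuclid x) (toEuclid y) / 2 := by
  have h2 : ‖(2 : ℝ) • (toEuclid v - midpoint ℝ (toEuclid x) (toEuclid y))‖ ≤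
      ‖toEuclid y - toEuclid x‖ := by
    rw [EuclideanSpace.norm_eq, EuclideanSpace.norm_eq]
    refine Real.sqrt_le_sqrt (Finset.sum_le_sum fun i _ => ?_)
    refine pow_le_pow_left₀ (norm_nonneg _) ?_ 2
    have e : ((2 : ℝ) • (toEuclid v - midpoint ℝ (toEuclid x) (toEuclid y))) i =
        ((2 * v i - x i - y i : ℤ) : ℝ) := by
      rw [midpoint_eq_smul_add]
      simp only [PiLp.smul_apply, PiLp.sub_apply, PiLp.add_apply, smul_eq_mul, toEuclid_apply]
      push_cast
      rw [invOf_eq_inv]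
      ring
    rw [e, PiLp.sub_apply, toEuclid_apply, toEuclid_apply, Real.norm_eq_abs, Real.norm_eq_abs]
    exact_mod_cast hv i
  rw [norm_smul, Real.norm_ofNat] at h2
  rw [dist_comm (toEuclid x), dist_eq_norm, dist_eq_norm]
  linarith

theorem toEuclid_displacedPoint (w : Fin d → ℤ) (k a b : Fin d) (h : ℕ) (p : ℕ × ℕ) :
    toEuclid (displacedPoint w k a b h p) = toEuclid (displacedPoint w k a b h 0) +
      (EuclideanSpace.single a (p.1 : ℝ) + EuclideanSpace.single b (p.2 : ℝ)) := by
  ext i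
  rw [PiLp.add_apply, PiLp.add_apply, toEuclid_apply, toEuclid_apply,
    PiLp.single_apply, PiLp.single_apply]
  simp only [displacedPoint]
  push_cast
  simp only [Prod.fst_zero, Prod.snd_zero, Nat.cast_zero, ite_self, add_zero]
  ring

/-- Points near a segment between two corners lie in the ball. -/
theorem displacedPoint_mem_ball {x y w : Fin d → ℤ} (hxy : x ≠ y) (k a b : Fin d) {L h : ℕ}
    {p : ℕ × ℕ} (hL : (L : ℤ) ≤ |y k - x k|) (hp1 : 2 * p.1 ≤ L) (hp2 : 2 * p.2 ≤ L)
    (hw : ∀ i, |2 * displacedPoint w k a b h 0 i - x i - y i| ≤ |y i - x i|) :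
    toEuclid (displacedPoint w k a b h p) ∈
      Metric.ball (midpoint ℝ (toEuclid x) (toEuclid y))
        (2 * dist (toEuclid x) (toEuclid y)) := by
  set D := dist (toEuclid x) (toEuclid y) with hD
  have hD0 : 0 < D := by
    rw [hD, dist_pos]
    intro heq
    refine hxy (funext fun i => ?_)
    have h := congrArg (fun z : EuclideanSpace ℝ (Fin d) => z i) heq
    simp only [toEuclid_apply] at h
    exact_mod_cast h
  have hLD : (L : ℝ) ≤ D := by
    refine le_trans ?_ (abs_sub_le_dist_toEuclid x y k)
    exact_mod_cast hL
  have h1 := dist_midpoint_le hw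
  rw [← hD] at h1
  -- The transverse displacement is at most `L ≤ D`, so the distance to the midpoint is at most `3 *
  -- D / 2 < 2 * D`.
  have h2 : dist (toEuclid (displacedPoint w k a b h p)) (toEuclid (displacedPoint w k a b h 0)) ≤
      p.1 + p.2 := by
    rw [toEuclid_displacedPoint, dist_eq_norm, add_sub_cancel_left]
    refine (norm_add_le _ _).trans (le_of_eq ?_)
    rw [PiLp.norm_single, PiLp.norm_single, Real.norm_natCast, Real.norm_natCast]
  have h3 : (2 : ℝ) * p.1 ≤ L := by exact_mod_cast hp1
  have h4 : (2 : ℝ) * p.2 ≤ L := by exact_mod_cast hp2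
  rw [Metric.mem_ball]
  have := dist_triangle (toEuclid (displacedPoint w k a b h p))
    (toEuclid (displacedPoint w k a b h 0)) (midpoint ℝ (toEuclid x) (toEuclid y))
  linarith

end Corners

/-! ### From axis-parallel segments to arbitrary pairs -/

section Chain

variable {m : ℕ} {G : Subgroup (Matrix.unitaryGroup (Fin m) ℂ)} [CompactSpace G] {d : ℕ}

/-- Alignment along axis-parallel segments gives alignment of all pairs of points. -/
theorem misalignment_le_of_axis {β s : ℝ} (hs : 0 ≤ s)
    {Λ bd : Finset (Fin d → ℤ)}
    (haxis : ∀ (w : Fin d → ℤ) (k : Fin d) (L : ℕ), 1 ≤ L →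
      (∀ a b : Fin d, k ≠ a → k ≠ b → a ≠ b → ∀ (h : ℕ) (p : ℕ × ℕ), h ≤ L → 2 * p.1 ≤ L →
        2 * p.2 ≤ L → displacedPoint w k a b h p ∈ Λ) →
      ∀ x y : Λ, (x : Fin d → ℤ) = w →
        (y : Fin d → ℤ) = (fun i => w i + if i = k then (L : ℤ) else 0) →
        misalignment (G := G) β bd x y ≤ s)
    (x y : Λ)
    (hball : ∀ z : Fin d → ℤ, toEuclid z ∈
      Metric.ball (midpoint ℝ (toEuclid (x : Fin d → ℤ)) (toEuclid (y : Fin d → ℤ)))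
        (2 * dist (toEuclid (x : Fin d → ℤ)) (toEuclid (y : Fin d → ℤ))) → z ∈ Λ) :
    misalignment (G := G) β bd x y ≤ 2 ^ (d + 1) * s := by
  by_cases hxy : (x : Fin d → ℤ) = y
  · rw [Subtype.ext hxy, misalignment_self]
    positivity
  have hmem : ∀ j, corner (x : Fin d → ℤ) y j ∈ Λ := by
    intro j
    refine hball _ (Metric.mem_ball.2 (lt_of_le_of_lt (dist_midpoint_le fun i => ?_) ?_))
    · unfold corner
      split_ifs <;> grind
    · have : 0 < dist (toEuclid (x : Fin d → ℤ)) (toEuclid (y : Fin d → ℤ)) := by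
        rw [dist_pos]
        intro heq
        refine hxy (funext fun i => ?_)
        have h := congrArg (fun z : EuclideanSpace ℝ (Fin d) => z i) heq
        simp only [toEuclid_apply] at h
        exact_mod_cast h
      linarith
  have hstep : ∀ j < d, misalignment (G := G) β bd ⟨corner (x : Fin d → ℤ) y j, hmem j⟩
      ⟨corner (x : Fin d → ℤ) y (j + 1), hmem (j + 1)⟩ ≤ s := by
    intro j hj
    rcases lt_trichotomy ((x : Fin d → ℤ) ⟨j, hj⟩) ((y : Fin d → ℤ) ⟨j, hj⟩) with h | h | h
    · obtain ⟨L, hL⟩ := Int.eq_ofNat_of_zero_le (sub_nonneg.2 h.le)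
      refine haxis (corner x y j) ⟨j, hj⟩ L (by omega) (fun a b hka hkb hab h' p hh hp1 hp2 => ?_)
        _ _ rfl ?_
      · refine hball _ (displacedPoint_mem_ball hxy _ a b (by rw [hL]; exact le_abs_self _) hp1 hp2
          fun i => ?_)
        simp only [displacedPoint, corner, Prod.fst_zero, Prod.snd_zero, Nat.cast_zero, ite_self,
          add_zero]
        by_cases hi : i = ⟨j, hj⟩
        · subst hi
          simp only [lt_irrefl, if_false, if_true]
          grind
        · rw [if_neg hi, add_zero]
          split_ifs <;> grind
      · funext i
        refine (corner_succ x y hj i).trans ?_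
        congr 1
        split_ifs with hi
        · rw [hi, hL]
        · rfl
    · have e : corner (x : Fin d → ℤ) y j = corner (x : Fin d → ℤ) y (j + 1) := by
        funext i
        rw [corner_succ (x : Fin d → ℤ) y hj i]
        split_ifs with hi
        · rw [hi, h]; simp
        · simp
      have e' : (⟨corner (x : Fin d → ℤ) y j, hmem j⟩ : Λ) =
          ⟨corner (x : Fin d → ℤ) y (j + 1), hmem (j + 1)⟩ := Subtype.ext e
      rw [e', misalignment_self]
      exact hs
    -- A decreasing coordinate: the segment is read from its other end.
    · obtain ⟨L, hL⟩ := Int.eq_ofNat_of_zero_le (sub_nonneg.2 h.le)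
      rw [misalignment_comm]
      refine haxis (corner x y (j + 1)) ⟨j, hj⟩ L (by omega)
        (fun a b hka hkb hab h' p hh hp1 hp2 => ?_) _ _ rfl ?_
      · refine hball _ (displacedPoint_mem_ball hxy _ a b
          (by rw [abs_sub_comm, hL]; exact le_abs_self _) hp1 hp2 fun i => ?_)
        simp only [displacedPoint, corner, Prod.fst_zero, Prod.snd_zero, Nat.cast_zero, ite_self,
          add_zero]
        by_cases hi : i = ⟨j, hj⟩
        · subst hi
          simp only [lt_add_iff_pos_right, zero_lt_one, if_true]
          grind
        · rw [if_neg hi, add_zero]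
          split_ifs <;> grind
      · funext i
        simp only
        rw [corner_succ x y hj i, add_assoc]
        split_ifs with hi
        · have hL' : (L : ℤ) = (x : Fin d → ℤ) ⟨j, hj⟩ - (y : Fin d → ℤ) ⟨j, hj⟩ := hL.symm
          rw [hi, hL']; ring
        · simp
  -- The constants solve `a (j + 1) = 2 * a j + 2` with `a 0 = 0`, from the triangle inequality for
  -- squares.
  have hchain : ∀ j ≤ d, misalignment (G := G) β bd ⟨corner (x : Fin d → ℤ) y 0, hmem 0⟩
      ⟨corner (x : Fin d → ℤ) y j, hmem j⟩ ≤ (2 ^ (j + 1) - 2) * s := by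
    intro j
    induction j with
    | zero => intro _; rw [misalignment_self]; norm_num
    | succ j ih =>
      intro hj
      have h1 := ih (by omega)
      have h2 := hstep j (by omega)
      have h3 := misalignment_le_add (G := G) β bd ⟨corner (x : Fin d → ℤ) y 0, hmem 0⟩
        ⟨corner (x : Fin d → ℤ) y j, hmem j⟩ ⟨corner (x : Fin d → ℤ) y (j + 1), hmem (j + 1)⟩
      have e : ((2 : ℝ) ^ (j + 1 + 1) - 2) * s = 2 * ((2 ^ (j + 1) - 2) * s) + 2 * s := by ring
      linarith
  have hx0 : (⟨corner (x : Fin d → ℤ) y 0, hmem 0⟩ : Λ) = x :=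
    Subtype.ext (corner_zero _ (y : Fin d → ℤ))
  have hyd : (⟨corner (x : Fin d → ℤ) y d, hmem d⟩ : Λ) = y :=
    Subtype.ext (corner_last (x : Fin d → ℤ) _)
  have h := hchain d le_rfl
  rw [hx0, hyd] at h
  refine h.trans (mul_le_mul_of_nonneg_right ?_ hs)
  linarith

theorem displacedPoint_zero_mem_box {n : ℕ} {k a b : Fin d} (hka : k ≠ a) (hkb : k ≠ b)
    (hab : a ≠ b) {h : ℕ} {p : ℕ × ℕ} (hh : h ≤ n) (hp1 : 2 * p.1 ≤ n) (hp2 : 2 * p.2 ≤ n) :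
    displacedPoint 0 k a b h p ∈ box d n := by
  rw [box, Finset.mem_Icc]
  constructor <;> intro i <;> simp only [displacedPoint, Pi.zero_apply] <;>
    split_ifs <;> omega

theorem endpoint_mem_innerBoundary (n : ℕ) (k : Fin d) :
    (fun i => if i = k then (n : ℤ) else 0) ∈ innerBoundary (box d n) := by
  classical
  unfold innerBoundary
  rw [Finset.mem_filter]
  refine ⟨?_, fun i => if i = k then (n : ℤ) + 1 else 0, ?_, ?_⟩
  · rw [box, Finset.mem_Icc]
    constructor <;> intro i <;> simp only <;> split_ifs <;> omega
  · refine adj_of_eq_of_ne k (fun j hj => by simp [hj]) ?_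
    simp
  · rw [box, Finset.mem_Icc]
    rintro ⟨-, h⟩
    have := h k
    simp only [if_true] at this
    omega

end Chain

end NishimoriSpin

end

/-! ### Long-range order and spontaneous magnetization -/

theorem theorem1p9 (d : ℕ) (hd : 3 ≤ d) (m : ℕ)
    (G : Subgroup (Matrix.unitaryGroup (Fin m) ℂ)) [CompactSpace G] :
    ∃ βstar a : ℝ, 0 < βstar ∧ 0 < a ∧ ∀ β : ℝ, βstar ≤ β →
      (∀ (Λ : Finset (Fin d → ℤ)) (x y : Fin d → ℤ) (hx : x ∈ Λ) (hy : y ∈ Λ),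
        (∀ z : Fin d → ℤ,
          NishimoriSpin.toEuclid z ∈
            Metric.ball (midpoint ℝ (NishimoriSpin.toEuclid x) (NishimoriSpin.toEuclid y))
              (2 * dist (NishimoriSpin.toEuclid x) (NishimoriSpin.toEuclid y)) → z ∈ Λ) →
        (1 - √(a * Real.log β / β)) * (m : ℝ) ≤
          NishimoriSpin.nishimoriExpectation G Λ β ∅
            (fun U => NishimoriSpin.reTr ((U ⟨x, hx⟩)⁻¹ * U ⟨y, hy⟩))) ∧
      (∀ bd : ℕ → Finset (Fin d → ℤ),
        (∀ n, NishimoriSpin.innerBoundary (NishimoriSpin.box d n) ⊆ bd n ∧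
          bd n ⊆ NishimoriSpin.box d n) →
        (1 - √(a * Real.log β / β)) * (m : ℝ) ≤
          Filter.liminf
            (fun n : ℕ => NishimoriSpin.nishimoriExpectation G (NishimoriSpin.box d n) β (bd n)
              (fun U => NishimoriSpin.reTr (U ⟨0, NishimoriSpin.zero_mem_box d n⟩)))
            Filter.atTop) := by
  obtain ⟨βstar, a, hβ0, ha0, hmain⟩ := NishimoriSpin.exists_uniform_axis_alignment d hd m G
  refine ⟨βstar, a, hβ0, ha0, fun β hβ => ?_⟩
  obtain ⟨t, ht0, ht, hal⟩ := hmain β hβ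
  have hm0 : (0 : ℝ) ≤ m := Nat.cast_nonneg m
  have htm := mul_le_mul_of_nonneg_right ht hm0
  constructor
  · intro Λ x y hx hy hball
    have h := NishimoriSpin.misalignment_le_of_axis (G := G) (β := β) (bd := ∅)
      (s := 8 * m * t) (by positivity) (hal Λ ∅) ⟨x, hx⟩ ⟨y, hy⟩ hball
    rw [NishimoriSpin.nishimoriExpectation_reTr]
    have e : (2 : ℝ) ^ (d + 1) * (8 * m * t) = 2 * (2 ^ (d + 3) * t * m) := by ring
    linarith
  · intro bd hbd
    -- A real `liminf` is meaningful only under a bound; here the magnetization is at most `m`.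
    refine Filter.le_liminf_of_le (Filter.IsBoundedUnder.isCoboundedUnder_ge
      (Filter.isBoundedUnder_of ⟨m, fun n => NishimoriSpin.nishimoriExpectation_reTr_le _ _ _⟩)) ?_
    filter_upwards [Filter.eventually_ge_atTop 1] with n hn
    -- One axis segment from the origin to this point, where the spin is 1, suffices; no chaining is
    -- needed.
    have hend := NishimoriSpin.endpoint_mem_innerBoundary n (⟨0, by omega⟩ : Fin d)
    have hbd' := (hbd n).1 hend
    rw [NishimoriSpin.nishimoriExpectation_reTr_of_mem β (bd n) _
      ⟨_, (hbd n).2 hbd'⟩ hbd']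
    have h := hal (NishimoriSpin.box d n) (bd n) 0 ⟨0, by omega⟩ n hn
      (fun a b hka hkb hab h p hh hp1 hp2 =>
        NishimoriSpin.displacedPoint_zero_mem_box hka hkb hab hh hp1 hp2)
      ⟨0, NishimoriSpin.zero_mem_box d n⟩ ⟨_, (hbd n).2 hbd'⟩ rfl (by funext i; simp)
    have e : (1 : ℝ) ≤ 2 ^ (d + 1) := one_le_pow₀ (by norm_num)
    have e2 : 4 * t * m ≤ 2 ^ (d + 3) * t * m := by
      have : (4 : ℝ) ≤ 2 ^ (d + 3) := by rw [show d + 3 = (d + 1) + 2 by ring, pow_add]; linarith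
      gcongr
    linarith
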